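/- \textbf{Theorem.} A circuit over the basis $\{\circ\}$ on inputs $x_0,\dots,x_{n-1}$ is an acyclic directed graph whose sources are the inputs and whose other vertices (the gates) each have an ordered pair of two distinct predecessors and compute $\circ$ of their values; every input has a successor, and some vertices are designated as outputs, including all vertices without successors. Its size $\mathrm{s}$ is the number of gates. Given arrival times $a(x_i)\in\mathbb{N}$ of the inputs, the arrival time of a gate with predecessors $u,v$ is $\max\{a(u),a(v)\}+1$, and the delay $\mathrm{del}$ is the maximum arrival time of an output. The circuit solves the prefix problem for $\circ:\{0,1\}\times\{0,1\}\to\{0,1\}$ if its outputs compute the prefixes $x_0\circ x_1\circ\dots\circ x_i$ for $i=0,\dots,n-1$. There is a polynomial-time algorithm that, for every $n\ge 3$ and all arrival times $a(x_0),\dots,a(x_{n-1})\in\mathbb{N}$, given the list of these arrival times, constructs a circuit $S_n$ over the basis $\{\circ\}$ which solves the prefix problem on $x_0,\dots,x_{n-1}$ for every associative operator $\circ:\{0,1\}\times\{0,1\}\to\{0,1\}$ and which satisfies, with $W=\sum_{i=0}^{n-1}2^{a(x_i)}$, $$\mathrm{del}(S_n)\le \log_2 W+3\log_2\log_2 n+0.007\qquad\text{and}\qquad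 \mathrm{s}(S_n)\le 3.114\,n\log_2\log_2 n .$$ Here polynomial time means: a fixed program for a machine that works on natural numbers and pairs, with addition, truncated subtraction, comparison, pairing and unpairing, and recursive calls, where every elementary operation counts one step, halts after at most $p(n)$ steps for a fixed polynomial $p$. -/

import Mathlib

/-!  Circuits over a basis with a single binary gate.  -/

/-- A circuit with `n` inputs and `m` designated outputs over a basis `{∘}` that consists of one
binary gate, given in a topological order: the vertices are numbered, the vertices
`0, …, n - 1` are the inputs `x₀, …, xₙ₋₁`, and the vertex `n + g` is the `g`-th gate, whose
ordered pair of predecessors is `gates[g]`.  The circuit says where the gates are; the operation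
which they compute is supplied when it is evaluated. -/
structure Circuit (n m : ℕ) where
  /-- the ordered pairs of predecessors of the gates -/
  gates : List (ℕ × ℕ)
  /-- the output vertices (inputs of the circuit are allowed as outputs) -/
  output : Fin m → Fin (n + gates.length)
  /-- the predecessors of a gate come earlier in the order -/
  pred_lt : ∀ (g : ℕ) (h : g < gates.length), gates[g].1 < n + g ∧ gates[g].2 < n + g
  /-- the two predecessors of a gate are distinct vertices -/
  pred_ne : ∀ e ∈ gates, e.1 ≠ e.2
  /-- every input has a successor -/
  input_used : ∀ v < n, ∃ e ∈ gates, e.1 = v ∨ e.2 = v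
  /-- every vertex without a successor is an output -/
  sink_output : ∀ v : Fin (n + gates.length),
    (∀ e ∈ gates, e.1 ≠ v ∧ e.2 ≠ v) → ∃ i, output i = v

namespace Circuit

variable {n m : ℕ} {α : Type*}

/-- The size of a circuit: its number of gates. -/
def size (C : Circuit n m) : ℕ := C.gates.length

/-- The labelling of the vertices that is `inp` on the inputs and that arises at every gate by
applying `f` to the labels of its two predecessors, in their order. -/
def label (C : Circuit n m) (inp : Fin n → α) (f : α → α → α)
    (v : Fin (n + C.gates.length)) : α :=
  if h : v.val < n then inp ⟨v.val, h⟩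
  else
    have hg : v.val - n < C.gates.length := by omega
    have hp := C.pred_lt (v.val - n) hg
    f (C.label inp f ⟨C.gates[v.val - n].1, by omega⟩)
      (C.label inp f ⟨C.gates[v.val - n].2, by omega⟩)
termination_by v.val
decreasing_by all_goals omega

/-- The value computed at a vertex if all gates compute `op` and the inputs are `x`. -/
def value (C : Circuit n m) (op : α → α → α) (x : Fin n → α) :
    Fin (n + C.gates.length) → α :=
  C.label x op

/-- The arrival time of a vertex, for given arrival times `a` of the inputs: a gate is one unit
later than the later one of its predecessors. -/
def arrival (C : Circuit n m) (a : Fin n → ℕ) : Fin (n + C.gates.length) → ℕ :=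
  C.label a (fun s t => max s t + 1)

/-- The delay of a circuit: the maximum arrival time of an output. -/
def delay (C : Circuit n m) (a : Fin n → ℕ) : ℕ :=
  Finset.univ.sup fun i : Fin m => C.arrival a (C.output i)

end Circuit

/-- The prefix `x₀ ∘ x₁ ∘ ⋯ ∘ xᵢ`. -/
def prefixValue {α : Type*} {n : ℕ} (op : α → α → α) (x : Fin n → α) :
    (i : ℕ) → i < n → α
  | 0, h => x ⟨0, h⟩
  | i + 1, h => op (prefixValue op x i (Nat.lt_of_succ_lt h)) (x ⟨i + 1, h⟩)

/-- The circuit solves the parallel prefix problem for `op`: its outputs are the prefixes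
`x₀ ∘ ⋯ ∘ xᵢ` for `i = 0, …, n - 1`. -/
def Circuit.SolvesPrefix {n : ℕ} (C : Circuit n n) (op : Bool → Bool → Bool) : Prop :=
  ∀ (x : Fin n → Bool) (i : Fin n), C.value op x (C.output i) = prefixValue op x i i.isLt

/-- The weight `W = ∑ 2 ^ a(xᵢ)` of inputs with arrival times `a`. -/
def weight {n : ℕ} (a : Fin n → ℕ) : ℕ := ∑ i, 2 ^ a i

/-!  A machine model with a step count: first-order recursive programs on natural numbers and
pairs.  Every elementary operation costs one step.  The only arithmetic operations are addition,
truncated subtraction and comparison, so that each step adds at most one bit to the length of the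
largest number in use, and polynomially many steps can be carried out in polynomial time by a
Turing machine. -/

/-- The data on which programs work. -/
inductive Val : Type
  | num (k : ℕ)
  | pair (a b : Val)

/-- Expressions.  Variables are de Bruijn indices into the current environment. -/
inductive Expr : Type
  /-- the `i`-th entry of the environment -/
  | var (i : ℕ)
  /-- a numerical constant -/
  | lit (k : ℕ)
  /-- addition -/
  | add (e₁ e₂ : Expr)
  /-- subtraction, cut off at `0` -/
  | sub (e₁ e₂ : Expr)
  /-- if `e₁ ≤ e₂` then `e₃` else `e₄` -/
  | ifLe (e₁ e₂ e₃ e₄ : Expr)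
  /-- form a pair -/
  | pair (e₁ e₂ : Expr)
  /-- evaluate `e` and continue with `e₁` if it is a number, which becomes variable `0`, or with
  `e₂` if it is a pair, whose components become variables `0` and `1` -/
  | cases (e e₁ e₂ : Expr)
  /-- evaluate `e₁`, make its value variable `0` and continue with `e₂` -/
  | letIn (e₁ e₂ : Expr)
  /-- call the `f`-th function of the program with the argument `e` -/
  | call (f : ℕ) (e : Expr)

/-- A program is a finite list of function bodies, which may call each other; each has its
argument as variable `0` and no other variable. -/
abbrev Program : Type := List Expr

/-- `Steps P env e v t`: in the program `P`, the evaluation of the expression `e` in the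
environment `env` terminates with the value `v` after exactly `t` steps. -/
inductive Steps (P : Program) : List Val → Expr → Val → ℕ → Prop
  | var {env : List Val} {i : ℕ} {v : Val} :
      env[i]? = some v → Steps P env (.var i) v 1
  | lit {env : List Val} {k : ℕ} :
      Steps P env (.lit k) (.num k) 1
  | add {env : List Val} {e₁ e₂ : Expr} {k₁ k₂ t₁ t₂ : ℕ} :
      Steps P env e₁ (.num k₁) t₁ → Steps P env e₂ (.num k₂) t₂ →
      Steps P env (.add e₁ e₂) (.num (k₁ + k₂)) (t₁ + t₂ + 1)
  | sub {env : List Val} {e₁ e₂ : Expr} {k₁ k₂ t₁ t₂ : ℕ} :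
      Steps P env e₁ (.num k₁) t₁ → Steps P env e₂ (.num k₂) t₂ →
      Steps P env (.sub e₁ e₂) (.num (k₁ - k₂)) (t₁ + t₂ + 1)
  | ifLe_true {env : List Val} {e₁ e₂ e₃ e₄ : Expr} {k₁ k₂ t₁ t₂ t : ℕ} {v : Val} :
      Steps P env e₁ (.num k₁) t₁ → Steps P env e₂ (.num k₂) t₂ → k₁ ≤ k₂ →
      Steps P env e₃ v t → Steps P env (.ifLe e₁ e₂ e₃ e₄) v (t₁ + t₂ + t + 1)
  | ifLe_false {env : List Val} {e₁ e₂ e₃ e₄ : Expr} {k₁ k₂ t₁ t₂ t : ℕ} {v : Val} :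
      Steps P env e₁ (.num k₁) t₁ → Steps P env e₂ (.num k₂) t₂ → k₂ < k₁ →
      Steps P env e₄ v t → Steps P env (.ifLe e₁ e₂ e₃ e₄) v (t₁ + t₂ + t + 1)
  | pair {env : List Val} {e₁ e₂ : Expr} {v₁ v₂ : Val} {t₁ t₂ : ℕ} :
      Steps P env e₁ v₁ t₁ → Steps P env e₂ v₂ t₂ →
      Steps P env (.pair e₁ e₂) (.pair v₁ v₂) (t₁ + t₂ + 1)
  | cases_num {env : List Val} {e e₁ e₂ : Expr} {k s t : ℕ} {v : Val} :
      Steps P env e (.num k) s → Steps P (.num k :: env) e₁ v t →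
      Steps P env (.cases e e₁ e₂) v (s + t + 1)
  | cases_pair {env : List Val} {e e₁ e₂ : Expr} {a b v : Val} {s t : ℕ} :
      Steps P env e (.pair a b) s → Steps P (a :: b :: env) e₂ v t →
      Steps P env (.cases e e₁ e₂) v (s + t + 1)
  | letIn {env : List Val} {e₁ e₂ : Expr} {u v : Val} {s t : ℕ} :
      Steps P env e₁ u s → Steps P (u :: env) e₂ v t →
      Steps P env (.letIn e₁ e₂) v (s + t + 1)
  | call {env : List Val} {f : ℕ} {e body : Expr} {u v : Val} {s t : ℕ} :
      P[f]? = some body → Steps P env e u s → Steps P [u] body v t →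
      Steps P env (.call f e) v (s + t + 1)

/-- The program `P`, started with its function `0` on the input `x`, halts with the output `y`
after exactly `t` steps. -/
def Program.HaltsWith (P : Program) (x y : Val) (t : ℕ) : Prop :=
  Steps P [x] (.call 0 (.var 0)) y t

/-- A list as a value. -/
def Val.ofList : List Val → Val
  | [] => .num 0
  | v :: vs => .pair v (Val.ofList vs)

/-- Arrival times as a value: the list `a(x₀), …, a(xₙ₋₁)`. -/
def encodeTimes {n : ℕ} (a : Fin n → ℕ) : Val :=
  Val.ofList (List.ofFn fun i => Val.num (a i))

/-- A circuit as a value: the list of the predecessor pairs of its gates, together with the list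
of its outputs. -/
def Circuit.encode {n m : ℕ} (C : Circuit n m) : Val :=
  .pair (Val.ofList (C.gates.map fun e => .pair (.num e.1) (.num e.2)))
    (Val.ofList (List.ofFn fun i => .num (C.output i).val))

/-! Put r ≈ √n (`root`) and cut the inputs into blocks of r consecutive ones; let m be the number of
blocks without the last. Each of these m blocks is combined into one formula, the prefix problem is
solved recursively for the m results and inside every block, and one further gate joins each prefix
inside a block to the prefix formed by all preceding blocks. The choice of r gives m r < n ≤ r (r +
1), so m ≤ r and m² ≤ n.

Delay. The invariant is 2 ^ time ≤ D(n) W with D = `delayFactor`; its logarithm is the claimed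
bound. Combining a list, without changing its order, gives 2 ^ time ≤ 4 · weight
(`time_combine_le`): a stack with strictly increasing levels imitates binary addition, where raising
formulas to common levels costs a factor 2 and the final collapse another one. The joining gate
costs a factor 2 as well. So D must satisfy 2 D(q) ≤ D(n) for q ≤ r (`two_mul_delayFactor_le`) and 2
· 4 · D(m) ≤ D(n) (`two_mul_combineFactor_mul_le`). Since log m ≤ (log n) / 2, the cube of log n
absorbs exactly this factor 8, whence the summand 3 log log n. The constant 0.007 is needed at n =
3.

Size. One level of the recursion adds m (r - 1) gates for combining and n - r for joining, fewer
than 2n together, and the recursion on m elements is cheap because m² ≤ n. As log n shrinks by a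
constant factor per level, there are O(log log n) levels; `sizeRate_root` and `sizeBound_rec` make
this quantitative.

Formulas are trees, but equal subformulas become one gate. `Adds` therefore counts distinct new
subformulas, and `emitAll` appends a gate only if it is missing, so that gates correspond
injectively to subformulas (`GatesFor.length_le`). Associativity enters only through the order of
the leaves: a formula with leaves 0, …, i has the value of the i-th prefix.

The algorithm is a transcription of these definitions into `prefixProgram`. Its correctness and step
count are verified function by function with the calculus `Expr.wp`. -/

/-! ### Formulas -/

/-- Formulas over the basis `{∘}`: binary trees whose leaves are numbers of inputs. -/
inductive Formula : Type
  | leaf (i : ℕ)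
  | node (l r : Formula)

namespace Formula

variable {α : Type*}

/-- The inputs of a formula, from left to right. -/
def leaves : Formula → List ℕ
  | leaf i => [i]
  | node l r => l.leaves ++ r.leaves

/-- The value of a formula if the inputs are `inp` and the gates compute `f`. -/
def fold (inp : ℕ → α) (f : α → α → α) : Formula → α
  | leaf i => inp i
  | node l r => f (l.fold inp f) (r.fold inp f)

/-- The arrival time of a formula. -/
def time (a : ℕ → ℕ) (t : Formula) : ℕ :=
  t.fold a (fun u v => max u v + 1)

/-- The subformulas that are not leaves. -/
def inner : Formula → List Formula
  | leaf _ => []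
  | node l r => node l r :: (l.inner ++ r.inner)

@[simp] theorem leaves_leaf (i : ℕ) : (leaf i).leaves = [i] := rfl
@[simp] theorem leaves_node (l r : Formula) : (node l r).leaves = l.leaves ++ r.leaves := rfl
@[simp] theorem time_leaf (a : ℕ → ℕ) (i : ℕ) : (leaf i).time a = a i := rfl
@[simp] theorem time_node (a : ℕ → ℕ) (l r : Formula) :
    (node l r).time a = max (l.time a) (r.time a) + 1 := rfl
@[simp] theorem inner_leaf (i : ℕ) : (leaf i).inner = [] := rfl
@[simp] theorem inner_node (l r : Formula) :
    (node l r).inner = node l r :: (l.inner ++ r.inner) := rfl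

theorem leaves_ne_nil (t : Formula) : t.leaves ≠ [] := by
  induction t <;> simp_all

theorem length_inner (t : Formula) : t.inner.length + 1 = t.leaves.length := by
  induction t with
  | leaf i => rfl
  | node l r hl hr => simp; omega

/-- The total weight `∑ 2 ^ time` of a list of formulas. -/
def weights (a : ℕ → ℕ) (xs : List Formula) : ℕ := (xs.map fun x => 2 ^ x.time a).sum

@[simp] theorem weights_nil (a : ℕ → ℕ) : weights a [] = 0 := rfl
@[simp] theorem weights_cons (a : ℕ → ℕ) (x : Formula) (xs : List Formula) :
    weights a (x :: xs) = 2 ^ x.time a + weights a xs := by simp [weights]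
@[simp] theorem weights_append (a : ℕ → ℕ) (xs ys : List Formula) :
    weights a (xs ++ ys) = weights a xs + weights a ys := by simp [weights]

theorem weights_take_add_drop (a : ℕ → ℕ) (k : ℕ) (xs : List Formula) :
    weights a (xs.take k) + weights a (xs.drop k) = weights a xs := by
  rw [← weights_append, List.take_append_drop]

theorem le_weights {a : ℕ → ℕ} {x : Formula} {xs : List Formula} (h : x ∈ xs) :
    2 ^ x.time a ≤ weights a xs :=
  List.single_le_sum (by simp) _ (List.mem_map_of_mem h)

theorem weights_le_of_sublist {a : ℕ → ℕ} {xs ys : List Formula} (h : xs.Sublist ys) :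
    weights a xs ≤ weights a ys :=
  (h.map _).sum_le_sum (by simp)

/-! ### Counting new gates -/

/-- All formulas in `ys` can be built from those in `xs` with at most `k` new gates. -/
def Adds (k : ℝ) (xs ys : List Formula) : Prop :=
  ∃ N : List Formula, (N.length : ℝ) ≤ k ∧
    ∀ y ∈ ys, ∀ t ∈ y.inner, t ∈ N ∨ ∃ x ∈ xs, t ∈ x.inner

namespace Adds

variable {k l : ℝ} {xs xs' ys zs : List Formula}

theorem of_subset (h : ys ⊆ xs) : Adds 0 xs ys :=
  ⟨[], by simp, fun y hy _ ht => .inr ⟨y, h hy, ht⟩⟩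

theorem mono (h : Adds k xs ys) (hk : k ≤ l) (hx : xs ⊆ xs') : Adds l xs' ys := by
  obtain ⟨N, hN, h⟩ := h
  refine ⟨N, hN.trans hk, fun y hy t ht => ?_⟩
  rcases h y hy t ht with h | ⟨x, h, h'⟩
  exacts [.inl h, .inr ⟨x, hx h, h'⟩]

theorem append (h : Adds k xs ys) (h' : Adds l xs zs) : Adds (k + l) xs (ys ++ zs) := by
  obtain ⟨N, hN, h⟩ := h
  obtain ⟨N', hN', h'⟩ := h'
  refine ⟨N ++ N', by push_cast [List.length_append]; linarith, fun y hy t ht => ?_⟩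
  rcases List.mem_append.1 hy with hy | hy
  · rcases h y hy t ht with h | h
    exacts [.inl (List.mem_append_left _ h), .inr h]
  · rcases h' y hy t ht with h | h
    exacts [.inl (List.mem_append_right _ h), .inr h]

theorem trans (h : Adds k xs ys) (h' : Adds l ys zs) : Adds (k + l) xs zs := by
  obtain ⟨N, hN, h⟩ := h
  obtain ⟨N', hN', h'⟩ := h'
  refine ⟨N ++ N', by push_cast [List.length_append]; linarith, fun z hz t ht => ?_⟩
  rcases h' z hz t ht with h1 | ⟨y, hy, h1⟩
  · exact .inl (List.mem_append_right _ h1)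
  · rcases h y hy t h1 with h | h
    exacts [.inl (List.mem_append_left _ h), .inr h]

theorem map_node (q : Formula) (ys : List Formula) :
    Adds ys.length (q :: ys) (ys.map (node q)) := by
  refine ⟨ys.map (node q), by simp, fun y hy t ht => ?_⟩
  obtain ⟨z, hz, rfl⟩ := List.mem_map.1 hy
  simp only [inner_node, List.mem_cons, List.mem_append] at ht
  rcases ht with rfl | ht | ht
  exacts [.inl hy, .inr ⟨q, by simp, ht⟩, .inr ⟨z, by simp [hz], ht⟩]

end Adds

/-! ### Combining a list of formulas into one -/

/-- `t` arises from the formulas of the list `xs`, each used once and in this order. -/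
inductive Built : List Formula → Formula → Prop
  | single (x : Formula) : Built [x] x
  | node {xs ys : List Formula} {l r : Formula} :
      Built xs l → Built ys r → Built (xs ++ ys) (node l r)

theorem Built.leaves_eq {xs : List Formula} {t : Formula} (h : Built xs t) :
    t.leaves = (xs.map leaves).flatten := by
  induction h with
  | single x => simp
  | node _ _ h h' => simp [h, h']

/-- A binary tree with k leaves has k - 1 inner nodes; here the leaves are the given formulas, whose
own subformulas are already available. -/
theorem Built.adds {xs : List Formula} {t : Formula} (h : Built xs t) :
    Adds (xs.length - 1) xs [t] := by
  induction h with
  | single x => simpa using Adds.of_subset (List.Subset.refl [x])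
  | @node xs ys l r _ _ h h' =>
    have h1 := (h.mono le_rfl (List.subset_append_left xs ys)).append
      (h'.mono le_rfl (List.subset_append_right xs ys))
    refine (h1.trans (Adds.map_node l [r])).mono ?_ (List.Subset.refl _)
    push_cast [List.length_append, List.length_singleton]
    linarith

/-- A stack of formulas with levels which arises from the list `xs`. -/
inductive StackOf : List Formula → List (Formula × ℕ) → Prop
  | nil : StackOf [] []
  | cons {xs ys : List Formula} {u : Formula} {s : ℕ} {st : List (Formula × ℕ)} :
      Built xs u → StackOf ys st → StackOf (xs ++ ys) ((u, s) :: st)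

/-- The total weight of a stack. -/
def stackWeight (st : List (Formula × ℕ)) : ℕ := (st.map fun p => 2 ^ p.2).sum

@[simp] theorem stackWeight_nil : stackWeight [] = 0 := rfl
@[simp] theorem stackWeight_cons (p : Formula × ℕ) (st : List (Formula × ℕ)) :
    stackWeight (p :: st) = 2 ^ p.2 + stackWeight st := by simp [stackWeight]

/-- The levels increase strictly, beginning with a level that is at least `k`, and no formula is
later than its level. -/
def Levels (a : ℕ → ℕ) : ℕ → List (Formula × ℕ) → Prop
  | _, [] => True
  | k, (u, s) :: st => k ≤ s ∧ u.time a ≤ s ∧ Levels a (s + 1) st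

theorem Levels.mono {a : ℕ → ℕ} {k l : ℕ} {st : List (Formula × ℕ)} (h : Levels a l st)
    (hk : k ≤ l) : Levels a k st := by
  cases st with
  | nil => trivial
  | cons p st => exact ⟨hk.trans h.1, h.2⟩

/-- Push `u` at level `t` on a stack, combining formulas at equal levels. -/
def carry (u : Formula) (t : ℕ) : List (Formula × ℕ) → List (Formula × ℕ)
  | [] => [(u, t)]
  | (v, s) :: st => if s ≤ t then carry (node u v) (t + 1) st else (u, t) :: (v, s) :: st

/-- Combine `u` with the entries below level `t`, and push the result at level `t`. -/
def sink (u : Formula) (t : ℕ) : List (Formula × ℕ) → List (Formula × ℕ)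
  | [] => [(u, t)]
  | (v, s) :: st => if t ≤ s then carry u t ((v, s) :: st) else sink (node u v) t st

/-- Push `x` on a stack at the level of its arrival time. -/
def push (a : ℕ → ℕ) (x : Formula) : List (Formula × ℕ) → List (Formula × ℕ)
  | [] => [(x, x.time a)]
  | (u, s) :: st =>
    if x.time a ≤ s then carry x (x.time a) ((u, s) :: st)
    else carry x (x.time a) (sink u (x.time a) st)

/-- Push all formulas of a list, beginning with the last one. -/
def stack (a : ℕ → ℕ) : List Formula → List (Formula × ℕ)
  | [] => []
  | x :: xs => push a x (stack a xs)

/-- Combine `u` with all entries of a stack. -/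
def collapse (u : Formula) : List (Formula × ℕ) → Formula
  | [] => u
  | (v, _) :: st => collapse (node u v) st

/-- Combine all formulas of a list. -/
def combine (a : ℕ → ℕ) (xs : List Formula) : Formula :=
  match stack a xs with
  | [] => leaf 0
  | (u, _) :: st => collapse u st

variable {a : ℕ → ℕ}

theorem StackOf.carry {ys : List Formula} {st : List (Formula × ℕ)} (h : StackOf ys st) :
    ∀ {xs : List Formula} {u : Formula} (t : ℕ), Built xs u →
      StackOf (xs ++ ys) (carry u t st) := by
  induction h with
  | nil => exact fun t hu => .cons hu .nil
  | @cons xs' ys v s st hv hst ih =>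
    intro xs u t hu
    simp only [Formula.carry]
    split_ifs
    · rw [← List.append_assoc]
      exact ih _ (hu.node hv)
    · exact .cons hu (.cons hv hst)

theorem StackOf.sink {ys : List Formula} {st : List (Formula × ℕ)} (h : StackOf ys st) :
    ∀ {xs : List Formula} {u : Formula} (t : ℕ), Built xs u →
      StackOf (xs ++ ys) (sink u t st) := by
  induction h with
  | nil => exact fun t hu => .cons hu .nil
  | @cons xs' ys v s st hv hst ih =>
    intro xs u t hu
    simp only [Formula.sink]
    split_ifs
    · exact (StackOf.cons hv hst).carry t hu
    · rw [← List.append_assoc]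
      exact ih _ (hu.node hv)

theorem stackOf_stack (a : ℕ → ℕ) (xs : List Formula) : StackOf xs (stack a xs) := by
  induction xs with
  | nil => exact .nil
  | cons x xs ih =>
    rw [stack]
    revert ih
    generalize stack a xs = st
    intro ih
    cases ih with
    | nil => exact .cons (.single x) .nil
    | cons hu hst =>
      rw [push]
      split_ifs
      · exact (StackOf.cons hu hst).carry _ (.single x)
      · exact (hst.sink _ hu).carry _ (.single x)

theorem StackOf.built_collapse {ys : List Formula} {st : List (Formula × ℕ)}
    (h : StackOf ys st) : ∀ {xs : List Formula} {u : Formula}, Built xs u →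
      Built (xs ++ ys) (collapse u st) := by
  induction h with
  | nil => intro xs u hu; simpa [collapse] using hu
  | cons hv _ ih =>
    intro xs u hu
    rw [← List.append_assoc]
    exact ih (hu.node hv)

theorem built_combine (a : ℕ → ℕ) {xs : List Formula} (h : xs ≠ []) :
    Built xs (combine a xs) := by
  have hs := stackOf_stack a xs
  unfold combine
  revert hs
  generalize stack a xs = st
  intro hs
  cases hs with
  | nil => exact absurd rfl h
  | cons hu hst => exact hst.built_collapse hu

/-- This is the carry of binary addition: two entries at level t are replaced by one at level t + 1,
so no weight is lost or gained. -/
theorem Levels.carry {st : List (Formula × ℕ)} :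
    ∀ {u : Formula} {t : ℕ}, Levels a t st → u.time a ≤ t →
      Levels a t (carry u t st) ∧ stackWeight (Formula.carry u t st) = 2 ^ t + stackWeight st := by
  induction st with
  | nil => exact fun _ hu => ⟨⟨le_rfl, hu, trivial⟩, by simp [Formula.carry]⟩
  | cons p st ih =>
    obtain ⟨v, s⟩ := p
    rintro u t ⟨hts, hv, hst⟩ hu
    simp only [Formula.carry]
    split_ifs with h
    · obtain rfl : s = t := le_antisymm h hts
      obtain ⟨h1, h2⟩ := @ih (.node u v) (s + 1) hst (by simp [hu, hv])
      exact ⟨h1.mono (by omega), by rw [h2]; simp; ring⟩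
    · exact ⟨⟨le_rfl, hu, by omega, hv, hst⟩, by simp⟩

/-- Joining upwards through strictly increasing levels below t stays within level t, because an
entry at level s leads to time at most s + 1 ≤ t. Raising the result to level t costs at most 2 ^ t,
whatever was absorbed. -/
theorem Levels.sink {st : List (Formula × ℕ)} :
    ∀ {u : Formula} {k t : ℕ}, Levels a k st → u.time a ≤ k → k ≤ t →
      Levels a t (sink u t st) ∧ stackWeight (Formula.sink u t st) ≤ 2 ^ t + stackWeight st := by
  induction st with
  | nil => exact fun _ hu hk => ⟨⟨le_rfl, hu.trans hk, trivial⟩, by simp [Formula.sink]⟩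
  | cons p st ih =>
    obtain ⟨v, s⟩ := p
    rintro u k t ⟨hks, hv, hst⟩ hu hk
    simp only [Formula.sink]
    split_ifs with h
    · obtain ⟨h1, h2⟩ := @Levels.carry a ((v, s) :: st) u t ⟨h, hv, hst⟩ (hu.trans hk)
      exact ⟨h1, h2.le⟩
    · obtain ⟨h1, h2⟩ := @ih (.node u v) (s + 1) t hst
        (by simp [hv, hu.trans hks]) (by omega)
      exact ⟨h1, by have := Nat.two_pow_pos s; simp; omega⟩

/-- A push at level t adds 2 ^ t for the formula itself and at most another 2 ^ t if lower entries
have to sink to level t; hence the factor 2. -/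
theorem levels_stack (a : ℕ → ℕ) (xs : List Formula) :
    Levels a 0 (stack a xs) ∧ stackWeight (stack a xs) ≤ 2 * weights a xs := by
  induction xs with
  | nil => exact ⟨trivial, by simp [stack]⟩
  | cons x xs ih =>
    rw [stack]
    revert ih
    generalize stack a xs = st
    rintro ⟨h1, h2⟩
    cases st with
    | nil => exact ⟨⟨by simp, le_rfl, trivial⟩, by simp [push]; omega⟩
    | cons p st =>
      obtain ⟨u, s⟩ := p
      obtain ⟨-, hu, hst⟩ := h1
      rw [push]
      split_ifs with h
      · obtain ⟨h3, h4⟩ := @Levels.carry a ((u, s) :: st) x _ ⟨h, hu, hst⟩ le_rfl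
        refine ⟨h3.mono (by simp), ?_⟩
        have := Nat.two_pow_pos (x.time a)
        rw [h4, weights_cons]
        omega
      · obtain ⟨h3, h4⟩ := Levels.sink (t := x.time a) hst (hu.trans (by simp)) (by omega)
        obtain ⟨h5, h6⟩ := Levels.carry h3 (le_refl (x.time a))
        refine ⟨h5.mono (by simp), ?_⟩
        rw [h6, weights_cons]
        have := Nat.two_pow_pos s
        simp at h2
        omega

/-- Collapsing starts at the lowest level. Since levels increase strictly, the accumulated formula
is never later than the next level, and it ends at most one unit after the highest one. An empty
stack costs nothing and is the second alternative. -/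
theorem Levels.time_collapse {st : List (Formula × ℕ)} :
    ∀ {u : Formula} {k : ℕ}, Levels a k st → u.time a ≤ k →
      2 ^ (collapse u st).time a ≤ 2 * stackWeight st ∨ collapse u st = u := by
  induction st with
  | nil => exact fun _ _ => .inr rfl
  | cons p st ih =>
    obtain ⟨v, s⟩ := p
    rintro u k ⟨hks, hv, hst⟩ hu
    left
    rcases @ih (.node u v) (s + 1) hst (by simp [hv, hu.trans hks]) with h | h
    · have := Nat.two_pow_pos s
      simp [collapse]; omega
    · have : (Formula.node u v).time a ≤ s + 1 := by simp [hv, hu.trans hks]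
      have := Nat.pow_le_pow_right (n := 2) (by norm_num) this
      simp only [collapse, h, stackWeight_cons]
      rw [pow_succ] at this
      omega

theorem time_combine_le (a : ℕ → ℕ) {xs : List Formula} (h : xs ≠ []) :
    2 ^ (combine a xs).time a ≤ 4 * weights a xs := by
  obtain ⟨h1, h2⟩ := levels_stack a xs
  have h3 := stackOf_stack a xs
  unfold combine
  revert h1 h2 h3
  generalize stack a xs = st
  intro h1 h2 h3
  cases h3 with
  | nil => exact absurd rfl h
  | @cons _ _ u s st =>
    obtain ⟨-, hu, hst⟩ := h1
    simp only [stackWeight_cons] at h2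
    rcases hst.time_collapse (hu.trans (by simp)) with h | h
    · have := Nat.two_pow_pos s
      simp only; omega
    · simp only [h]
      have := Nat.pow_le_pow_right (n := 2) (by norm_num) hu
      omega

theorem combine_singleton (a : ℕ → ℕ) (x : Formula) : combine a [x] = x := rfl

/-- Two formulas meet in a single gate, which gives the factor 2 instead of 4; without this
improvement the delay bound would fail for blocks of length 2, for instance at n = 3. -/
theorem combine_pair (a : ℕ → ℕ) (x y : Formula) : combine a [x, y] = node x y := by
  simp only [combine, stack, push]
  split_ifs with h
  · simp only [carry]
    split_ifs <;> rfl
  · simp [sink, carry, collapse]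

/-- An upper bound on `2 ^ t` for the arrival time `t` of the combination of `r` formulas,
relative to their weight. -/
def combineFactor (r : ℕ) : ℝ := if r ≤ 1 then 1 else if r = 2 then 2 else 4

theorem time_combine_le_factor (a : ℕ → ℕ) {xs : List Formula} {r : ℕ} (h : xs.length = r)
    (hr : r ≠ 0) : (2 : ℝ) ^ (combine a xs).time a ≤ combineFactor r * weights a xs := by
  have h0 : xs ≠ [] := by rintro rfl; exact hr h.symm
  unfold combineFactor
  split_ifs with h1 h2
  · obtain ⟨x, rfl⟩ := List.length_eq_one_iff.1 (show xs.length = 1 by omega)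
    simp [combine_singleton]
  · obtain ⟨x, y, rfl⟩ := List.length_eq_two.1 (h.trans h2)
    simp only [combine_pair, time_node, weights_cons, weights_nil]
    push_cast
    rw [pow_succ]
    rcases max_choice (x.time a) (y.time a) with h | h <;> rw [h]
    · nlinarith [pow_pos (zero_lt_two (α := ℝ)) (y.time a)]
    · nlinarith [pow_pos (zero_lt_two (α := ℝ)) (x.time a)]
  · exact_mod_cast time_combine_le a h0

end Formula

/-! ### Numerical bounds -/

/-- The least `r` with `n ≤ r * (r + 1)`, computed by counting `n` down; `c` is the number of
steps before `r` grows. -/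
def rootAux : ℕ → ℕ → ℕ → ℕ
  | 0, r, _ => r
  | n + 1, r, 0 => rootAux n (r + 1) (r + r + 1)
  | n + 1, r, c + 1 => rootAux n r c

/-- The least `r` with `n ≤ r * (r + 1)`. -/
def root (n : ℕ) : ℕ := rootAux n 0 0

/-- The counter c is the unused part of the capacity r (r + 1). When it is exhausted, raising r to r
+ 1 adds 2 (r + 1) places, one of which is taken at once; this leaves 2 r + 1 and needs no
multiplication. -/
theorem rootAux_spec (n : ℕ) : ∀ r c : ℕ, c < 2 * r →
    r * (r + 1) + n ≤ rootAux n r c * (rootAux n r c + 1) + c ∧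
      rootAux n r c * rootAux n r c + c < r * (r + 1) + n + rootAux n r c := by
  induction n with
  | zero => intro r c h; simp only [rootAux]; constructor <;> nlinarith
  | succ n ih =>
    rintro r (_ | c) h
    · obtain ⟨h1, h2⟩ := ih (r + 1) (r + r + 1) (by omega)
      simp only [rootAux]
      constructor <;> nlinarith
    · obtain ⟨h1, h2⟩ := ih r c (by omega)
      simp only [rootAux]
      constructor <;> omega

theorem root_spec {n : ℕ} (hn : 1 ≤ n) :
    n ≤ root n * (root n + 1) ∧ root n * root n < n + root n := by
  obtain ⟨n, rfl⟩ := Nat.exists_eq_add_of_le' hn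
  -- The start r = c = 0 violates c < 2 r; after the first count the state is r = c = 1.
  have := rootAux_spec n 1 1 (by norm_num)
  simp only [root, rootAux, zero_add, add_zero]
  constructor <;> omega

/-- An upper bound on `2 ^ t` for the delay `t` of the prefix circuits, relative to the weight. -/
noncomputable def delayFactor (n : ℕ) : ℝ :=
  if n ≤ 1 then 1 else if n = 2 then 2 else 2 ^ (0.007 : ℝ) * Real.logb 2 n ^ 3

/-- An upper bound on the number of gates per input. -/
noncomputable def sizeRate (n : ℕ) : ℝ :=
  3.114 * Real.logb 2 (Real.logb 2 (max n 3 : ℕ))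

/-- An upper bound on the number of gates. -/
noncomputable def sizeBound (n : ℕ) : ℝ :=
  if n ≤ 1 then 0 else if n = 2 then 1 else if n = 3 then 3 else if n = 4 then 5
  else if n = 5 then 8 else if n = 6 then 10 else n * sizeRate n

theorem logb_two_mono {x y : ℝ} (hx : 0 < x) (h : x ≤ y) : Real.logb 2 x ≤ Real.logb 2 y :=
  Real.logb_le_logb_of_le (by norm_num) hx h

/-- Rational bounds on logarithms are certified by comparing powers, which `norm_num` can decide. -/
theorem rat_le_logb_two {p q : ℕ} {x : ℝ} (hq : 0 < q) (h : 2 ^ p ≤ x ^ q) :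
    (p / q : ℝ) ≤ Real.logb 2 x := by
  have h1 := logb_two_mono (by positivity) h
  rw [Real.logb_pow, Real.logb_pow, Real.logb_self_eq_one (by norm_num)] at h1
  rw [div_le_iff₀ (by positivity)]
  linarith

theorem logb_two_le_rat {p q : ℕ} {x : ℝ} (hq : 0 < q) (hx : 0 < x) (h : x ^ q ≤ 2 ^ p) :
    Real.logb 2 x ≤ (p / q : ℝ) := by
  have h1 := logb_two_mono (by positivity) h
  rw [Real.logb_pow, Real.logb_pow, Real.logb_self_eq_one (by norm_num)] at h1
  rw [le_div_iff₀ (by positivity)]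
  linarith

theorem logb_two_le_mul_logb_two {m n p q : ℕ} (hm : 0 < m) (hq : 0 < q) (h : m ^ q ≤ n ^ p) :
    Real.logb 2 m ≤ p / q * Real.logb 2 n := by
  have h1 := logb_two_mono (x := (m : ℝ) ^ q) (y := (n : ℝ) ^ p) (by positivity)
    (by exact_mod_cast h)
  rw [Real.logb_pow, Real.logb_pow] at h1
  rw [div_mul_eq_mul_div, le_div_iff₀ (by positivity)]
  linarith

theorem le_logb_two_three : (84 / 53 : ℝ) ≤ Real.logb 2 3 := by
  simpa using rat_le_logb_two (p := 84) (q := 53) (x := 3) (by norm_num) (by norm_num)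

theorem logb_two_three_le : Real.logb 2 3 ≤ 65 / 41 := by
  simpa using logb_two_le_rat (p := 65) (q := 41) (x := 3) (by norm_num) (by norm_num)
    (by norm_num)

theorem logb_two_three_le_logb {n : ℕ} (h : 3 ≤ n) : Real.logb 2 3 ≤ Real.logb 2 n :=
  logb_two_mono (by norm_num) (by exact_mod_cast h)

/-- The fraction is chosen so that 3 · 97 / 146 + 0.007 still exceeds 2. -/
theorem le_logb_logb_three : (97 / 146 : ℝ) ≤ Real.logb 2 (Real.logb 2 3) := by
  refine le_trans ?_ (logb_two_mono (by norm_num) le_logb_two_three)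
  simpa using rat_le_logb_two (p := 97) (q := 146) (x := 84 / 53) (by norm_num) (by norm_num)

theorem logb_logb_pos {n : ℕ} (h : 3 ≤ n) : 97 / 146 ≤ Real.logb 2 (Real.logb 2 n) :=
  le_logb_logb_three.trans (logb_two_mono (by linarith [le_logb_two_three])
    (logb_two_three_le_logb h))

theorem one_le_delayConst : (1 : ℝ) ≤ 2 ^ (0.007 : ℝ) :=
  Real.one_le_rpow (by norm_num) (by norm_num)

theorem delayFactor_of_three_le {n : ℕ} (h : 3 ≤ n) :
    delayFactor n = 2 ^ (0.007 : ℝ) * Real.logb 2 n ^ 3 := by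
  rw [delayFactor, if_neg (by omega), if_neg (by omega)]

theorem delayFactor_eq_rpow {n : ℕ} (h : 3 ≤ n) :
    delayFactor n = 2 ^ (3 * Real.logb 2 (Real.logb 2 n) + 0.007) := by
  have h1 : 0 < Real.logb 2 n :=
    lt_of_lt_of_le (by linarith [le_logb_two_three]) (logb_two_three_le_logb h)
  rw [delayFactor_of_three_le h, Real.rpow_add (by norm_num), mul_comm 3, Real.rpow_mul (by norm_num),
    Real.rpow_logb (by norm_num) (by norm_num) h1, mul_comm]
  norm_cast

/-- This is where 0.007 comes from: for n = 3 the recursion needs 2 · 2 · 1 = 4, while (log₂ 3)³ ≈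
3.98. -/
theorem four_le_delayFactor {n : ℕ} (h : 3 ≤ n) : 4 ≤ delayFactor n := by
  rw [delayFactor_eq_rpow h]
  calc (4 : ℝ) = 2 ^ (2 : ℝ) := by norm_num
    _ ≤ _ := Real.rpow_le_rpow_of_exponent_le (by norm_num) (by linarith [logb_logb_pos h])

theorem delayFactor_nonneg (n : ℕ) : 0 ≤ delayFactor n := by
  unfold delayFactor
  split_ifs
  · norm_num
  · norm_num
  · rcases Nat.eq_zero_or_pos n with rfl | h
    · simp
    · have := Real.logb_nonneg (b := 2) (by norm_num) (show (1 : ℝ) ≤ n by exact_mod_cast h)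
      positivity

theorem delayFactor_le_two {n : ℕ} (h : n ≤ 2) : delayFactor n ≤ 2 := by
  unfold delayFactor
  split_ifs
  · norm_num
  · norm_num
  · omega

theorem pow_three_le_delayFactor {n : ℕ} (h : 3 ≤ n) {x : ℝ} (hx : 0 ≤ x)
    (hxn : x ≤ Real.logb 2 n) : x ^ 3 ≤ delayFactor n := by
  rw [delayFactor_of_three_le h]
  have := pow_le_pow_left₀ hx hxn 3
  nlinarith [one_le_delayConst, pow_nonneg hx 3]

/-- The delay inside the blocks. -/
theorem two_mul_delayFactor_le {n q : ℕ} (hn : 2 ≤ n) (hq : q ≤ root n) :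
    2 * delayFactor q ≤ delayFactor n := by
  obtain ⟨-, h2⟩ := root_spec (show 1 ≤ n by omega)
  have hr : q * q < n + q := by
    obtain ⟨d, hd⟩ := Nat.exists_eq_add_of_le hq
    rw [hd] at h2
    nlinarith [Nat.le_mul_self d]
  rcases hn.eq_or_lt with rfl | hn
  · obtain rfl | rfl : q = 0 ∨ q = 1 := by
      have : q < 2 := by nlinarith
      omega
    all_goals norm_num [delayFactor]
  rcases le_or_gt q 2 with h | h
  · linarith [four_le_delayFactor hn, delayFactor_le_two h]
  · have hL := logb_two_three_le_logb h
    have hL3 := le_logb_two_three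
    -- From q (q - 1) < n. It gives log q ≤ (3/4) log n, and 2 · (3/4)³ = 27/32 < 1.
    have hpow : q ^ 4 ≤ n ^ 3 := by
      obtain ⟨p, rfl⟩ := Nat.exists_eq_add_of_lt h
      have : (2 + p + 1) * (2 + p) + 1 ≤ n := by nlinarith
      refine le_trans ?_ (Nat.pow_le_pow_left this 3)
      ring_nf
      linarith [Nat.zero_le p, Nat.zero_le (p ^ 2), Nat.zero_le (p ^ 3), Nat.zero_le (p ^ 4),
        Nat.zero_le (p ^ 5), Nat.zero_le (p ^ 6)]
    have h3 := logb_two_le_mul_logb_two (by omega) (by norm_num) hpow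
    norm_num at h3
    rw [delayFactor_of_three_le h, delayFactor_of_three_le hn]
    have h4 := pow_le_pow_left₀ (by linarith) h3 3
    have h5 : 0 ≤ Real.logb 2 n := by linarith
    have h6 := one_le_delayConst
    have h7 : 2 * Real.logb 2 q ^ 3 ≤ Real.logb 2 n ^ 3 := by
      nlinarith [pow_nonneg h5 3]
    nlinarith

/-- The delay across the blocks. -/
theorem two_mul_combineFactor_mul_le {n m : ℕ} (hn : 2 ≤ n) (hm : m * root n < n) :
    2 * (Formula.combineFactor (root n) * delayFactor m) ≤ delayFactor n := by
  obtain ⟨h1, h2⟩ := root_spec (show 1 ≤ n by omega)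
  set r := root n
  have hmr : m ≤ r := by nlinarith
  rcases hn.eq_or_lt with rfl | hn
  · have hr : r = 1 := by
      have : r < 3 := by nlinarith
      interval_cases r <;> omega
    have : m ≤ 1 := by omega
    norm_num [hr, Formula.combineFactor, delayFactor, this]
  have hr2 : 2 ≤ r := by nlinarith
  have hL3 := le_logb_two_three
  rcases hr2.eq_or_lt with hr2 | hr3
  · have hτ : Formula.combineFactor r = 2 := by norm_num [Formula.combineFactor, ← hr2]
    rw [hτ]
    -- For n ≤ 4 there is one head, and 4 is needed. Otherwise m ≤ 2, and 2 · 2 · 2 = 8 = 2³ is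
    -- needed, where log₂ n ≥ 2.
    rcases le_or_gt n 4 with h4 | h4
    · have hm1 : m ≤ 1 := by
        rw [← hr2] at hm
        omega
      have : delayFactor m = 1 := if_pos hm1
      linarith [four_le_delayFactor hn]
    · have hL := logb_two_mono (x := 4) (y := n) (by norm_num) (by exact_mod_cast h4.le)
      have h8 := pow_three_le_delayFactor hn (x := 2) (by norm_num)
        (by have := rat_le_logb_two (p := 2) (q := 1) (x := 4) (by norm_num) (by norm_num)
            norm_num at this
            linarith)
      have := delayFactor_le_two (show m ≤ 2 by omega)
      linarith
  · have hτ : Formula.combineFactor r = 4 := by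
      rw [Formula.combineFactor, if_neg (by omega), if_neg (by omega)]
    rw [hτ]
    have hn7 : 7 ≤ n := by nlinarith
    -- For m ≤ 2 the requirement is 2 · 4 · 2 = 16 < (13/5)³. For m ≥ 3 it is the main case m² ≤ n,
    -- in which 2 · 4 = 2³ is used up exactly.
    rcases le_or_gt m 2 with hm2 | hm3
    · have hL := logb_two_mono (x := 7) (y := n) (by norm_num) (by exact_mod_cast hn7)
      have h8 := pow_three_le_delayFactor hn (x := 13 / 5) (by norm_num)
        (by have := rat_le_logb_two (p := 13) (q := 5) (x := 7) (by norm_num) (by norm_num)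
            norm_num at this
            linarith)
      have := delayFactor_le_two hm2
      linarith
    · have h3 := logb_two_le_mul_logb_two (m := m) (n := n) (p := 1) (q := 2) (by omega)
        (by norm_num) (by nlinarith)
      norm_num at h3
      have hL := logb_two_three_le_logb hm3
      rw [delayFactor_of_three_le hm3, delayFactor_of_three_le hn]
      have h4 := pow_le_pow_left₀ (by linarith) h3 3
      have h6 := one_le_delayConst
      have h7 : 8 * Real.logb 2 m ^ 3 ≤ Real.logb 2 n ^ 3 := by linarith
      nlinarith

theorem two_le_sizeRate (n : ℕ) : 2 ≤ sizeRate n := by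
  have := logb_logb_pos (n := max n 3) (by omega)
  unfold sizeRate
  linarith

theorem sizeBound_le_mul (n : ℕ) : sizeBound n ≤ n * sizeRate n := by
  have h := two_le_sizeRate n
  have h0 := mul_le_mul_of_nonneg_left h (Nat.cast_nonneg (α := ℝ) n)
  unfold sizeBound
  split_ifs with h1 h2 h3 h4 h5 h6
  · exact le_trans (by positivity) h0
  all_goals first | exact le_rfl | (subst_vars; push_cast at *; linarith)

theorem sizeRate_mono {m n : ℕ} (h : m ≤ n) : sizeRate m ≤ sizeRate n := by
  have h1 := logb_two_three_le_logb (n := max m 3) (by omega)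
  have h2 := logb_two_mono (x := (max m 3 : ℕ)) (y := (max n 3 : ℕ)) (by positivity)
    (by exact_mod_cast (by omega : max m 3 ≤ max n 3))
  have h3 := logb_two_mono (by linarith [le_logb_two_three]) h2
  unfold sizeRate
  linarith

/-- Concavity: the graph lies below its tangent at x; 1.4428 is an upper bound for 1 / ln 2. -/
theorem logb_two_le_tangent {x y : ℝ} (hx : 0 < x) (hy : x ≤ y) :
    Real.logb 2 y ≤ Real.logb 2 x + 1.4428 * (y / x - 1) := by
  have h0 : 0 < y := hx.trans_le hy
  have h1 : 0 ≤ y / x - 1 := by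
    rw [sub_nonneg, le_div_iff₀ hx]
    linarith
  have h2 := Real.log_le_sub_one_of_pos (div_pos h0 hx)
  have h3 : 1 ≤ 1.4428 * Real.log 2 := by linarith [Real.log_two_gt_d9]
  rw [← sub_le_iff_le_add', ← Real.logb_div h0.ne' hx.ne', Real.logb,
    div_le_iff₀ (Real.log_pos (by norm_num))]
  nlinarith

theorem logb_two_eight : Real.logb 2 8 = 3 := by
  rw [show (8 : ℝ) = 2 ^ 3 by norm_num, Real.logb_pow, Real.logb_self_eq_one (by norm_num)]
  norm_num

theorem sizeRate_le_of_le {n k : ℕ} {x y : ℝ} (h : n ≤ k) (hk : 3 ≤ k) (hx : Real.logb 2 k ≤ x)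
    (hy : Real.logb 2 x ≤ y) : sizeRate n ≤ 3.114 * y := by
  refine (sizeRate_mono h).trans ?_
  rw [sizeRate, max_eq_left hk]
  have := logb_two_mono (by linarith [le_logb_two_three, logb_two_three_le_logb hk]) hx
  linarith

/-- This bounds the recursion on the m heads by 0.4912 m² + 2 m gates. As m² ≤ n, it fits into the
0.4912 n that the gain 2.4912 n of `sizeRate_root` leaves beyond 2 n. -/
theorem sizeRate_le {m : ℕ} (hm : 1 ≤ m) : sizeRate m ≤ 0.4912 * m + 2 := by
  have hm' : (1 : ℝ) ≤ m := by exact_mod_cast hm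
  rcases le_or_gt m 3 with h3 | h3
  · have := sizeRate_le_of_le (k := 3) (x := 65 / 41) (y := 2 / 3) h3 le_rfl
      (by exact_mod_cast logb_two_three_le)
      (by simpa using logb_two_le_rat (p := 2) (q := 3) (x := 65 / 41) (by norm_num)
            (by norm_num) (by norm_num))
    linarith
  have h4 : (4 : ℝ) ≤ m := by exact_mod_cast h3
  rcases le_or_gt m 5 with h5 | h5
  · have := sizeRate_le_of_le (k := 5) (x := 7 / 3) (y := 5 / 4) h5 (by norm_num)
      (by simpa using logb_two_le_rat (p := 7) (q := 3) (x := 5) (by norm_num)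
            (by norm_num) (by norm_num))
      (by simpa using logb_two_le_rat (p := 5) (q := 4) (x := 7 / 3) (by norm_num)
            (by norm_num) (by norm_num))
    linarith
  have h6 : (6 : ℝ) ≤ m := by exact_mod_cast h5
  rcases le_or_gt m 8 with h8 | h8
  · have := sizeRate_le_of_le (k := 8) (x := 3) (y := 65 / 41) h8 (by norm_num)
      (by exact_mod_cast logb_two_eight.le) logb_two_three_le
    linarith
  have h9 : (8 : ℝ) ≤ m := by exact_mod_cast h8.le
  have hL := logb_two_le_tangent (by norm_num) h9
  have hL3 := logb_two_mono (by norm_num) h9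
  rw [logb_two_eight] at hL hL3
  have := logb_two_le_tangent (by norm_num) hL3
  have := logb_two_three_le
  rw [sizeRate, max_eq_left (by omega)]
  linarith

/-- From r (r - 1) < n and r ≥ 3 follows r ^ 7 ≤ n ^ 4, nearly tight at r = 3, n = 7. So log n ≥
(7/4) log r, the iterated logarithm grows by log₂ (7/4) ≥ 4/5, and 3.114 · 4/5 = 2.4912. -/
theorem sizeRate_root {n : ℕ} (hn : 7 ≤ n) : sizeRate (root n) + 2.4912 ≤ sizeRate n := by
  obtain ⟨h1, h2⟩ := root_spec (show 1 ≤ n by omega)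
  set r := root n
  have hr : 3 ≤ r := by nlinarith
  have hpow : r ^ 7 ≤ n ^ 4 := by
    obtain ⟨p, hp⟩ := Nat.exists_eq_add_of_le' hr
    rw [hp] at h2 ⊢
    have : (p + 3) * (p + 2) + 1 ≤ n := by nlinarith
    refine le_trans ?_ (Nat.pow_le_pow_left this 4)
    ring_nf
    linarith [Nat.zero_le p, Nat.zero_le (p ^ 2), Nat.zero_le (p ^ 3), Nat.zero_le (p ^ 4),
      Nat.zero_le (p ^ 5), Nat.zero_le (p ^ 6), Nat.zero_le (p ^ 7), Nat.zero_le (p ^ 8)]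
  have h3 := logb_two_le_mul_logb_two (by omega) (by norm_num) hpow
  have h4 := logb_two_three_le_logb hr
  have h5 := logb_two_three_le_logb (show 3 ≤ n by omega)
  have h6 := le_logb_two_three
  have h7 : Real.logb 2 r * (7 / 4) ≤ Real.logb 2 n := by
    norm_num at h3
    linarith
  have h8 := logb_two_mono (by linarith) h7
  rw [Real.logb_mul (by linarith) (by norm_num)] at h8
  have h9 := rat_le_logb_two (p := 4) (q := 5) (x := 7 / 4) (by norm_num) (by norm_num)
  norm_num at h9
  rw [sizeRate, sizeRate, max_eq_left hr, max_eq_left (by omega)]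
  linarith

/-- The recursion for the number of gates. -/
theorem sizeBound_rec {n m q : ℕ} (hn : 2 ≤ n) (hq : 1 ≤ q) (hqr : q ≤ root n)
    (hmq : n = m * root n + q) :
    m * sizeBound (root n) + sizeBound q + sizeBound m + m * (root n - 1 : ℝ) + (n - root n)
      ≤ sizeBound n := by
  obtain ⟨h1, h2⟩ := root_spec (show 1 ≤ n by omega)
  rcases le_or_gt n 6 with h6 | h6
  -- The tabulated values of `sizeBound` for n ≤ 6 are those produced by the recursion itself.
  · generalize root n = r at *
    have hr3 : r ≤ 2 := by nlinarith
    have hm5 : m ≤ 5 := by nlinarith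
    interval_cases r
    · omega
    · obtain rfl : n = 2 := by omega
      obtain rfl : q = 1 := by omega
      obtain rfl : m = 1 := by omega
      norm_num [sizeBound]
    · interval_cases q <;> interval_cases m <;> subst hmq <;> first | omega | norm_num [sizeBound]
  · set r := root n
    have hσ := sizeRate_root h6
    have hr1 : 1 ≤ r := by omega
    have hm1 : 1 ≤ m := by
      rcases Nat.eq_zero_or_pos m with rfl | h
      · nlinarith
      · exact h
    have hmr : m ≤ r := by nlinarith
    have hB : sizeBound n = n * sizeRate n := by
      simp only [sizeBound]
      rw [if_neg (by omega), if_neg (by omega), if_neg (by omega), if_neg (by omega),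
        if_neg (by omega), if_neg (by omega)]
    have hBr := sizeBound_le_mul r
    have hBq : sizeBound q ≤ q * sizeRate r :=
      (sizeBound_le_mul q).trans (by gcongr; exact sizeRate_mono hqr)
    have hBm : sizeBound m ≤ m * (0.4912 * m + 2) :=
      (sizeBound_le_mul m).trans (by gcongr; exact sizeRate_le hm1)
    have hn' : (n : ℝ) = m * r + q := by exact_mod_cast hmq
    have hmr' : (m : ℝ) ≤ r := by exact_mod_cast hmr
    have hq' : (1 : ℝ) ≤ q := by exact_mod_cast hq
    have hm' : (1 : ℝ) ≤ m := by exact_mod_cast hm1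
    have e1 : (m : ℝ) * sizeBound r ≤ m * (r * sizeRate r) := by gcongr
    have e2 : (n : ℝ) * (sizeRate r + 2.4912) ≤ n * sizeRate n := by gcongr
    have e3 : (m : ℝ) * m ≤ m * r := by gcongr
    rw [hB]
    -- With m r = n - q, what remains is 0.4912 m² + m - q - r ≤ 0.4912 n, which follows from m² ≤ m
    -- r ≤ n and m ≤ r.
    refine le_trans ?_ e2
    have e4 : (n : ℝ) * sizeRate r = m * (r * sizeRate r) + q * sizeRate r := by rw [hn']; ring
    nlinarith

namespace Formula

/-! ### The prefix construction -/

/-- The combinations of the blocks of `r` consecutive formulas of a list, without the last block,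
which may be shorter. -/
def heads (a : ℕ → ℕ) (r : ℕ) (xs : List Formula) : List Formula :=
  if _h : r = 0 ∨ xs.length ≤ r then [] else combine a (xs.take r) :: heads a r (xs.drop r)
termination_by xs.length
decreasing_by simp only [List.length_drop]; omega

/-- Apply `F` to the blocks of `r` consecutive formulas of a list, and combine all formulas of
the `j`-th resulting list with the `j`-th formula of the list `qs`. -/
def distribute (F : List Formula → List Formula) (r : ℕ) :
    List Formula → List Formula → List Formula
  | [], _ => []
  | q :: qs, xs => (F (xs.take r)).map (node q) ++ distribute F r qs (xs.drop r)

/-- Formulas for all prefixes of a list of at most `k` formulas. -/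
def prefixes (a : ℕ → ℕ) : ℕ → List Formula → List Formula
  | 0, xs => xs
  | k + 1, xs =>
    if xs.length ≤ 1 then xs
    else
      prefixes a k (xs.take (root xs.length)) ++
        distribute (prefixes a k) (root xs.length) (prefixes a k (heads a (root xs.length) xs))
          (xs.drop (root xs.length))

variable {a : ℕ → ℕ}

theorem heads_of_le {r : ℕ} {xs : List Formula} (h : xs.length ≤ r) : heads a r xs = [] := by
  rw [heads, dif_pos (.inr h)]

theorem heads_of_lt {r : ℕ} {xs : List Formula} (h0 : r ≠ 0) (h : r < xs.length) :
    heads a r xs = combine a (xs.take r) :: heads a r (xs.drop r) := by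
  rw [heads, dif_neg (by omega)]

/-- A list is either one block, or it begins with a block. -/
theorem blocks_induction {r : ℕ} (hr : r ≠ 0) {motive : List Formula → Prop}
    (short : ∀ xs, xs.length ≤ r → motive xs)
    (long : ∀ xs, r < xs.length → motive (xs.drop r) → motive xs) (xs : List Formula) :
    motive xs := by
  induction h : xs.length using Nat.strong_induction_on generalizing xs with
  | _ n ih =>
    rcases le_or_gt xs.length r with hx | hx
    · exact short xs hx
    · exact long xs hx (ih _ (by simp only [List.length_drop]; omega) _ rfl)

/-- Here q is the length of the last block, which has no head and is never empty. -/
theorem length_heads {r : ℕ} (hr : r ≠ 0) (xs : List Formula) (hx : xs ≠ []) :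
    ∃ q, 1 ≤ q ∧ q ≤ r ∧ xs.length = (heads a r xs).length * r + q := by
  induction xs using blocks_induction hr with
  | short xs h =>
    have := List.length_pos_iff.2 hx
    exact ⟨xs.length, this, h, by simp [heads_of_le h]⟩
  | long xs h ih =>
    obtain ⟨q, h1, h2, h3⟩ := ih (by
      rw [← List.length_pos_iff, List.length_drop]; omega)
    refine ⟨q, h1, h2, ?_⟩
    rw [heads_of_lt hr h, List.length_cons, add_mul, one_mul]
    rw [List.length_drop] at h3
    omega

theorem length_heads_mul_lt {r : ℕ} (hr : r ≠ 0) {xs : List Formula} (hx : xs ≠ []) :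
    (heads a r xs).length * r < xs.length := by
  obtain ⟨q, h1, -, h3⟩ := length_heads (a := a) hr xs hx
  omega

theorem length_heads_lt {r : ℕ} (hr : r ≠ 0) {xs : List Formula} (hx : xs ≠ []) :
    (heads a r xs).length < xs.length :=
  lt_of_le_of_lt (Nat.le_mul_of_pos_right _ (Nat.pos_of_ne_zero hr)) (length_heads_mul_lt hr hx)

theorem root_ne_zero {n : ℕ} (hn : 1 ≤ n) : root n ≠ 0 := by
  intro h
  have := (root_spec hn).1
  simp [h] at this
  omega

theorem root_lt {n : ℕ} (hn : 2 ≤ n) : root n < n := by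
  have := (root_spec (show 1 ≤ n by omega)).2
  nlinarith

/-! #### Correctness -/

/-- The prefixes of a list of words, with `p` put in front. -/
def scanWords (p : List ℕ) : List (List ℕ) → List (List ℕ)
  | [] => []
  | w :: ws => (p ++ w) :: scanWords (p ++ w) ws

theorem length_scanWords (ws : List (List ℕ)) : ∀ p, (scanWords p ws).length = ws.length := by
  induction ws with
  | nil => intro p; rfl
  | cons w ws ih => intro p; simp [scanWords, ih]

theorem scanWords_append (ws ws' : List (List ℕ)) : ∀ p,
    scanWords p (ws ++ ws') = scanWords p ws ++ scanWords (p ++ ws.flatten) ws' := by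
  induction ws with
  | nil => intro p; simp [scanWords]
  | cons w ws ih => intro p; simp [scanWords, ih]

theorem map_append_scanWords (p : List ℕ) (ws : List (List ℕ)) : ∀ p',
    (scanWords p' ws).map (p ++ ·) = scanWords (p ++ p') ws := by
  induction ws with
  | nil => intro p'; rfl
  | cons w ws ih => intro p'; simp [scanWords, ih]

theorem getElem_scanWords (ws : List (List ℕ)) : ∀ (p : List ℕ) (i : ℕ)
    (h : i < (scanWords p ws).length), (scanWords p ws)[i] = p ++ (ws.take (i + 1)).flatten := by
  induction ws with
  | nil => intro p i h; simp [scanWords] at h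
  | cons w ws ih =>
    rintro p (_ | i) h
    · simp [scanWords]
    · simp [scanWords, ih]

/-- The word p is what precedes the first block of `xs`. Each head appends the word of its block, so
the formulas in `qs` carry exactly the words that precede the successive blocks. -/
theorem map_leaves_distribute {F : List Formula → List Formula} {r : ℕ} (hr : r ≠ 0)
    (hF : ∀ xs : List Formula, xs.length ≤ r → (F xs).map leaves = scanWords [] (xs.map leaves))
    (xs : List Formula) : ∀ (p : List ℕ) (qs : List Formula),
      qs.map leaves = p :: scanWords p ((heads a r xs).map leaves) →
      (distribute F r qs xs).map leaves = scanWords p (xs.map leaves) := by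
  have key : ∀ (p : List ℕ) (q : Formula) (ys : List Formula), q.leaves = p → ys.length ≤ r →
      ((F ys).map (node q)).map leaves = scanWords p (ys.map leaves) := by
    intro p q ys hq hy
    have := map_append_scanWords p (ys.map leaves) []
    rw [← hF ys hy, List.append_nil] at this
    rw [← this, List.map_map, List.map_map]
    refine List.map_congr_left fun y _ => ?_
    simp [hq]
  induction xs using blocks_induction hr with
  | short xs h =>
    intro p qs hqs
    rw [heads_of_le h] at hqs
    obtain ⟨q, qs, rfl⟩ : ∃ q qs', qs = q :: qs' := by
      cases qs with
      | nil => simp at hqs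
      | cons q qs => exact ⟨q, qs, rfl⟩
    simp only [List.map_cons, List.map_nil, scanWords, List.cons.injEq, List.map_eq_nil_iff] at hqs
    rw [hqs.2, distribute, distribute, List.take_of_length_le h, List.append_nil,
      key p q xs hqs.1 h]
  | long xs h ih =>
    intro p qs hqs
    rw [heads_of_lt hr h] at hqs
    obtain ⟨q, qs, rfl⟩ : ∃ q qs', qs = q :: qs' := by
      cases qs with
      | nil => simp at hqs
      | cons q qs => exact ⟨q, qs, rfl⟩
    simp only [List.map_cons, scanWords, List.cons.injEq] at hqs
    have hb : (combine a (xs.take r)).leaves = ((xs.take r).map leaves).flatten :=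
      (built_combine a (by rw [← List.length_pos_iff, List.length_take]; omega)).leaves_eq
    rw [distribute, List.map_append, key p q _ hqs.1 (by simp), ih (p ++ _) qs hqs.2, hb,
      ← scanWords_append, ← List.map_append, List.take_append_drop]

theorem map_leaves_prefixes (a : ℕ → ℕ) (k : ℕ) : ∀ xs : List Formula, xs.length ≤ k →
    (prefixes a k xs).map leaves = scanWords [] (xs.map leaves) := by
  induction k with
  | zero =>
    intro xs h
    obtain rfl := List.length_eq_zero_iff.1 (Nat.le_zero.1 h)
    rfl
  | succ k ih =>
    intro xs h
    rw [prefixes]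
    split_ifs with h1
    · rcases xs with _ | ⟨x, _ | ⟨y, xs⟩⟩
      · rfl
      · simp [scanWords]
      · simp at h1
    · set r := root xs.length with hrdef
      have hx : xs ≠ [] := by rintro rfl; simp at h1
      have hr : r ≠ 0 := root_ne_zero (by omega)
      have hrx : r < xs.length := root_lt (by omega)
      have hh := length_heads_lt (a := a) hr hx
      have hb : (combine a (xs.take r)).leaves = ((xs.take r).map leaves).flatten :=
        (built_combine a (by rw [← List.length_pos_iff, List.length_take]; omega)).leaves_eq
      rw [List.map_append, ih _ (by rw [List.length_take]; omega),
        map_leaves_distribute (a := a) hr (fun ys hy => ih ys (by omega)) _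
          ((xs.take r).map leaves).flatten]
      · nth_rw 4 [← List.take_append_drop r xs]
        rw [List.map_append, scanWords_append, List.nil_append]
      · rw [ih _ (by omega), heads_of_lt hr hrx, List.map_cons, scanWords, hb, List.nil_append]

theorem length_prefixes {k : ℕ} {xs : List Formula} (h : xs.length ≤ k) :
    (prefixes a k xs).length = xs.length := by
  have := congrArg List.length (map_leaves_prefixes a k xs h)
  simpa [length_scanWords] using this

/-! #### Delay -/

theorem weights_heads_le (a : ℕ → ℕ) {r : ℕ} (hr : r ≠ 0) (xs : List Formula) :
    (weights a (heads a r xs) : ℝ) ≤ combineFactor r * weights a xs := by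
  have h0 : 0 ≤ combineFactor r := by unfold combineFactor; split_ifs <;> norm_num
  induction xs using blocks_induction hr with
  | short xs h => rw [heads_of_le h]; simp; positivity
  | long xs h ih =>
    have h1 := time_combine_le_factor a (xs := xs.take r) (by simp; omega) hr
    rw [heads_of_lt hr h, weights_cons, ← weights_take_add_drop a r xs]
    push_cast
    linarith

theorem mem_distribute {F : List Formula → List Formula} {r : ℕ} {y : Formula}
    (qs : List Formula) : ∀ xs : List Formula, y ∈ distribute F r qs xs →
      ∃ q ∈ qs, ∃ ys : List Formula, ys.length ≤ r ∧ ys.Sublist xs ∧ ∃ z ∈ F ys, y = node q z := by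
  induction qs with
  | nil => intro xs h; simp [distribute] at h
  | cons q qs ih =>
    intro xs h
    rcases List.mem_append.1 h with h | h
    · obtain ⟨z, hz, rfl⟩ := List.mem_map.1 h
      exact ⟨q, by simp, _, by simp, List.take_sublist r xs, z, hz, rfl⟩
    · obtain ⟨q', hq', ys, h1, h2, z, hz, rfl⟩ := ih _ h
      exact ⟨q', by simp [hq'], ys, h1, h2.trans (List.drop_sublist r xs), z, hz, rfl⟩

/-- At a joining gate both predecessors satisfy 2 · 2 ^ time ≤ D(n) W: the prefix inside a block
because a block weighs at most W, the prefix of blocks because the heads weigh at most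
`combineFactor r` times W. -/
theorem time_prefixes_le (a : ℕ → ℕ) (k : ℕ) : ∀ xs : List Formula, xs.length ≤ k →
    ∀ y ∈ prefixes a k xs, (2 : ℝ) ^ y.time a ≤ delayFactor xs.length * weights a xs := by
  induction k with
  | zero =>
    intro xs h y hy
    obtain rfl := List.length_eq_zero_iff.1 (Nat.le_zero.1 h)
    simp [prefixes] at hy
  | succ k ih =>
    intro xs h y hy
    rw [prefixes] at hy
    split_ifs at hy with h1
    · rw [delayFactor, if_pos h1, one_mul]
      exact_mod_cast le_weights hy
    · set r := root xs.length with hrdef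
      have hx : xs ≠ [] := by rintro rfl; simp at h1
      have hr : r ≠ 0 := root_ne_zero (by omega)
      have hrx : r < xs.length := root_lt (by omega)
      have hh := length_heads_lt (a := a) hr hx
      have block : ∀ ys : List Formula, ys.length ≤ r → ys.Sublist xs → ∀ z ∈ prefixes a k ys,
          2 * (2 : ℝ) ^ z.time a ≤ delayFactor xs.length * weights a xs := by
        intro ys h2 h3 z hz
        have h4 := ih ys (by omega) z hz
        have h5 : (weights a ys : ℝ) ≤ weights a xs := by exact_mod_cast weights_le_of_sublist h3
        have h6 := two_mul_delayFactor_le (n := xs.length) (q := ys.length) (by omega) h2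
        have h7 := delayFactor_nonneg ys.length
        have h8 := delayFactor_nonneg xs.length
        calc 2 * (2 : ℝ) ^ z.time a ≤ 2 * (delayFactor ys.length * weights a ys) := by linarith
          _ = 2 * delayFactor ys.length * weights a ys := by ring
          _ ≤ _ := by gcongr
      rcases List.mem_append.1 hy with hy | hy
      · have := block _ (by simp) (List.take_sublist r xs) y hy
        have : (0 : ℝ) < 2 ^ y.time a := by positivity
        linarith
      · obtain ⟨q, hq, ys, h2, h3, z, hz, rfl⟩ := mem_distribute _ _ hy
        have h4 := block ys h2 (h3.trans (List.drop_sublist r xs)) z hz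
        have h5 := ih _ (by omega) q hq
        have h6 := weights_heads_le a hr xs
        have h7 := two_mul_combineFactor_mul_le (n := xs.length) (by omega)
          (length_heads_mul_lt (a := a) hr hx)
        have h8 : 2 * (2 : ℝ) ^ q.time a ≤ delayFactor xs.length * weights a xs := by
          have h9 := delayFactor_nonneg (heads a r xs).length
          calc 2 * (2 : ℝ) ^ q.time a
              ≤ 2 * (delayFactor (heads a r xs).length * (combineFactor r * weights a xs)) := by
                have := mul_le_mul_of_nonneg_left h6 h9
                linarith
            _ = 2 * (combineFactor r * delayFactor (heads a r xs).length) * weights a xs := by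
                ring
            _ ≤ _ := by gcongr
        rw [time_node, pow_succ]
        rcases max_choice (q.time a) (z.time a) with h | h <;> rw [h] <;> linarith

/-! #### Size -/

theorem adds_heads (a : ℕ → ℕ) {r : ℕ} (hr : r ≠ 0) (xs : List Formula) :
    Adds ((heads a r xs).length * (r - 1 : ℝ)) xs (heads a r xs) := by
  induction xs using blocks_induction hr with
  | short xs h => rw [heads_of_le h]; simpa using Adds.of_subset (List.nil_subset xs)
  | long xs h ih =>
    have hl : (xs.take r).length = r := by simp; omega
    have h1 := (built_combine a (xs := xs.take r)
      (by rw [← List.length_pos_iff, hl]; omega)).adds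
    rw [hl] at h1
    rw [heads_of_lt hr h]
    have h2 := (h1.mono le_rfl (List.take_subset r xs)).append
      (ih.mono le_rfl (List.drop_subset r xs))
    refine h2.mono ?_ (List.Subset.refl _)
    push_cast [List.length_cons]
    linarith

theorem adds_distribute {F : List Formula → List Formula} {r : ℕ}
    (hF : ∀ ys : List Formula, ys.length ≤ r →
      Adds (sizeBound ys.length) ys (F ys) ∧ (F ys).length = ys.length)
    {q : ℕ} (hq : 1 ≤ q) (hqr : q ≤ r) (qs : List Formula) : ∀ (xs : List Formula) (m : ℕ),
      qs.length = m + 1 → xs.length = m * r + q →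
      Adds (m * sizeBound r + sizeBound q + xs.length) (qs ++ xs) (distribute F r qs xs) := by
  have key : ∀ (q : Formula) (qs xs ys : List Formula), ys.length ≤ r → ys ⊆ xs →
      -- One block: the gates of its own prefixes, and one joining gate for each of its elements.
      Adds (sizeBound ys.length + ys.length) (q :: qs ++ xs) ((F ys).map (node q)) := by
    intro q qs xs ys h hy
    obtain ⟨h1, h2⟩ := hF ys h
    have h3 := Adds.map_node q (F ys)
    rw [h2] at h3
    have h4 : Adds (sizeBound ys.length) (q :: qs ++ xs) (q :: F ys) := by
      have h5 := (Adds.of_subset (xs := q :: qs ++ xs) (ys := [q]) (by simp)).append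
        (h1.mono le_rfl (fun y h => List.mem_append_right (q :: qs) (hy h)))
      rw [zero_add] at h5
      exact h5
    exact h4.trans h3
  induction qs with
  | nil => intro xs m h; simp at h
  | cons p qs ih =>
    rintro xs (_ | m) h1 h2
    · obtain rfl := List.length_eq_zero_iff.1 (show qs.length = 0 by simpa using h1)
      have h3 := key p [] xs xs (by omega) (List.Subset.refl _)
      rw [distribute, distribute, List.append_nil, List.take_of_length_le (by omega)]
      simp only [zero_mul, zero_add] at h2
      simpa [h2] using h3
    · have hl : (xs.take r).length = r := by
        rw [List.length_take, h2, add_mul]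
        have := Nat.zero_le (m * r)
        omega
      have hd : (xs.drop r).length = m * r + q := by
        rw [List.length_drop, h2, add_mul]
        omega
      have h3 := key p qs xs (xs.take r) (by omega) (List.take_subset r xs)
      have h4 := ih (xs.drop r) m (by simpa using h1) hd
      rw [distribute]
      refine (h3.append (h4.mono le_rfl ?_)).mono ?_ (List.Subset.refl _)
      · intro y hy
        rcases List.mem_append.1 hy with hy | hy
        · exact List.mem_append_left _ (List.mem_cons_of_mem _ hy)
        · exact List.mem_append_right _ (List.drop_subset r xs hy)
      · rw [hl, hd, h2]
        push_cast
        linarith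

theorem adds_prefixes (a : ℕ → ℕ) (k : ℕ) : ∀ xs : List Formula, xs.length ≤ k →
    Adds (sizeBound xs.length) xs (prefixes a k xs) := by
  induction k with
  | zero =>
    intro xs h
    obtain rfl := List.length_eq_zero_iff.1 (Nat.le_zero.1 h)
    simpa [sizeBound, prefixes] using Adds.of_subset (List.Subset.refl ([] : List Formula))
  | succ k ih =>
    intro xs h
    rw [prefixes]
    split_ifs with h1
    · rw [sizeBound, if_pos h1]
      exact Adds.of_subset (List.Subset.refl _)
    · set r := root xs.length with hrdef
      have hx : xs ≠ [] := by rintro rfl; simp at h1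
      have hr : r ≠ 0 := root_ne_zero (by omega)
      have hrx : r < xs.length := root_lt (by omega)
      have hh := length_heads_lt (a := a) hr hx
      obtain ⟨q, hq, hqr, hlen⟩ := length_heads (a := a) hr xs hx
      have hrec := sizeBound_rec (n := xs.length) (by omega) hq hqr hlen
      -- The first block needs no joining; behind it there are m full blocks and the last one.
      obtain ⟨m, hm⟩ : ∃ m, (heads a r xs).length = m + 1 := by
        rw [heads_of_lt hr hrx]; exact ⟨_, rfl⟩
      have hfirst := ih (xs.take r) (by rw [List.length_take]; omega)
      rw [List.length_take, min_eq_left hrx.le] at hfirst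
      have hheads := (adds_heads a hr xs).trans (ih (heads a r xs) (by omega))
      have hrest := adds_distribute (F := prefixes a k)
        (fun ys hy => ⟨ih ys (by omega), length_prefixes (by omega)⟩) hq hqr
        (prefixes a k (heads a r xs)) (xs.drop r) m
        (by rw [length_prefixes (by omega), hm])
        (by rw [List.length_drop]; rw [hm, add_mul] at hlen; omega)
      have hsrc := hheads.append (Adds.of_subset (List.drop_subset r xs))
      refine ((hfirst.mono le_rfl (List.take_subset r xs)).append (hsrc.trans hrest)).mono ?_
        (List.Subset.refl _)
      rw [← hrdef, hm] at hrec
      rw [hm, List.length_drop, Nat.cast_sub hrx.le]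
      rw [← hm] at hrec ⊢
      push_cast [hm] at hrec ⊢
      linarith

end Formula

namespace Formula

/-! ### From formulas to circuits -/

/-- The list `G` of gates represents the formula `t` at the vertex `v`. -/
def Rep (n : ℕ) (G : List (ℕ × ℕ)) : Formula → ℕ → Prop
  | leaf i, v => v = i
  | node l r, v => ∃ g u w, v = n + g ∧ G[g]? = some (u, w) ∧ Rep n G l u ∧ Rep n G r w

variable {n : ℕ} {G G' : List (ℕ × ℕ)}

theorem Rep.mono (hG : G <+: G') {t : Formula} : ∀ {v : ℕ}, Rep n G t v → Rep n G' t v := by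
  induction t with
  | leaf i => exact fun h => h
  | node l r hl hr =>
    rintro v ⟨g, u, w, rfl, hg, h1, h2⟩
    refine ⟨g, u, w, rfl, ?_, hl h1, hr h2⟩
    obtain ⟨H, rfl⟩ := hG
    rw [List.getElem?_append_left (List.getElem?_eq_some_iff.1 hg).1, hg]

theorem Rep.lt {t : Formula} {v : ℕ} (h : Rep n G t v) (ht : ∀ i ∈ t.leaves, i < n) :
    v < n + G.length := by
  cases t with
  | leaf i =>
    have h' : v = i := h
    have := ht i (by simp)
    omega
  | node l r =>
    obtain ⟨g, u, w, rfl, hg, -⟩ := h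
    have := (List.getElem?_eq_some_iff.1 hg).1
    omega

/-- A formula is represented at no more than one vertex if all gates are different. -/
theorem Rep.unique (hG : G.Nodup) {t : Formula} : ∀ {v v' : ℕ}, Rep n G t v → Rep n G t v' →
    v = v' := by
  induction t with
  | leaf i => intro v v' h h'; exact Eq.trans h (Eq.symm h')
  | node l r hl hr =>
    rintro v v' ⟨g, u, w, rfl, hg, h1, h2⟩ ⟨g', u', w', rfl, hg', h1', h2'⟩
    obtain rfl := hl h1 h1'
    obtain rfl := hr h2 h2'
    have := (List.getElem?_inj (List.getElem?_eq_some_iff.1 hg).1 hG).1 (hg.trans hg'.symm)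
    rw [this]

/-- The inputs of a formula are determined by the vertex that represents it. -/
theorem Rep.leaves_eq {t : Formula} : ∀ {t' : Formula} {v : ℕ}, (∀ i ∈ t.leaves, i < n) →
    (∀ i ∈ t'.leaves, i < n) → Rep n G t v → Rep n G t' v → t.leaves = t'.leaves := by
  induction t with
  | leaf i =>
    intro t' v ht ht' h h'
    have h : v = i := h
    have hi := ht i (by simp)
    cases t' with
    | leaf j =>
      have h' : v = j := h'
      simp [← h, ← h']
    | node l r =>
      obtain ⟨g, u, w, rfl, -⟩ := h'
      omega
  | node l r hl hr =>
    rintro t' v ht ht' ⟨g, u, w, rfl, hg, h1, h2⟩ h'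
    cases t' with
    | leaf j =>
      have h' : n + g = j := h'
      have := ht' j (by simp)
      omega
    | node l' r' =>
      obtain ⟨g', u', w', hgg, hg', h1', h2'⟩ := h'
      obtain rfl : g = g' := by omega
      obtain ⟨rfl, rfl⟩ := Prod.mk.inj (Option.some.inj (hg.symm.trans hg'))
      simp only [leaves_node, List.mem_append] at ht ht' ⊢
      rw [hl (fun i h => ht i (.inl h)) (fun i h => ht' i (.inl h)) h1 h1',
        hr (fun i h => ht i (.inr h)) (fun i h => ht' i (.inr h)) h2 h2']

/-- Search the gate `e` in a list whose first gate is the vertex `v`, append it if it does not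
occur, and return the list and the vertex of the gate. -/
def insertGate (e : ℕ × ℕ) : ℕ → List (ℕ × ℕ) → List (ℕ × ℕ) × ℕ
  | v, [] => ([e], v)
  | v, e' :: G =>
    if e' = e then (e' :: G, v)
    else (e' :: (insertGate e (v + 1) G).1, (insertGate e (v + 1) G).2)

/-- Add the gates that are missing for the formula `t`. -/
def emit (n : ℕ) : Formula → List (ℕ × ℕ) → List (ℕ × ℕ) × ℕ
  | leaf i, G => (G, i)
  | node l r, G =>
    insertGate ((emit n l G).2, (emit n r (emit n l G).1).2) n (emit n r (emit n l G).1).1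

/-- Add the gates that are missing for a list of formulas. -/
def emitAll (n : ℕ) : List Formula → List (ℕ × ℕ) → List (ℕ × ℕ) × List ℕ
  | [], G => (G, [])
  | t :: ts, G =>
    ((emitAll n ts (emit n t G).1).1, (emit n t G).2 :: (emitAll n ts (emit n t G).1).2)

theorem insertGate_spec (e : ℕ × ℕ) (G : List (ℕ × ℕ)) : ∀ v : ℕ,
    ∃ g, (insertGate e v G).2 = v + g ∧ (insertGate e v G).1[g]? = some e ∧
      ((insertGate e v G).1 = G ∨ e ∉ G ∧ (insertGate e v G).1 = G ++ [e]) := by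
  induction G with
  | nil => exact fun v => ⟨0, by simp [insertGate]⟩
  | cons e' G ih =>
    intro v
    rw [insertGate]
    split_ifs with h
    · exact ⟨0, by simp [h]⟩
    · obtain ⟨g, h1, h2, h3⟩ := ih (v + 1)
      refine ⟨g + 1, by rw [h1]; ring, by simpa using h2, ?_⟩
      rcases h3 with h3 | ⟨h3, h4⟩
      · exact .inl (by rw [h3])
      · exact .inr ⟨by simp [h3, Ne.symm h], by rw [h4]; rfl⟩

/-- The gates are different, they are in topological order, and they represent formulas in `A`. -/
structure GatesFor (n : ℕ) (A : List Formula) (G : List (ℕ × ℕ)) : Prop where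
  nodup : G.Nodup
  lt : ∀ g u w, G[g]? = some (u, w) → u < n + g ∧ w < n + g
  rep : ∀ e ∈ G, ∃ l r, node l r ∈ A ∧ Rep n G l e.1 ∧ Rep n G r e.2

variable {A : List Formula}

/-- A new gate goes to the end, and its predecessors already represent formulas in G, so the
topological order persists. Appending only missing gates keeps all gates different. -/
theorem GatesFor.insertGate (h : GatesFor n A G) {l r : Formula} {u w : ℕ}
    (hA : node l r ∈ A) (hA' : ∀ i ∈ (node l r).leaves, i < n) (hl : Rep n G l u)
    (hr : Rep n G r w) :
    GatesFor n A (insertGate (u, w) n G).1 ∧ G <+: (Formula.insertGate (u, w) n G).1 ∧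
      Rep n (Formula.insertGate (u, w) n G).1 (node l r) (Formula.insertGate (u, w) n G).2 := by
  obtain ⟨g, h1, h2, h3⟩ := insertGate_spec (u, w) G n
  have hp : G <+: (Formula.insertGate (u, w) n G).1 := by
    rcases h3 with h3 | ⟨-, h3⟩ <;> rw [h3]
    exact List.prefix_append _ _
  refine ⟨?_, hp, g, u, w, h1, h2, hl.mono hp, hr.mono hp⟩
  rcases h3 with h3 | ⟨h3, h4⟩
  · rwa [h3]
  · rw [h4] at hp ⊢
    have hu := hl.lt (fun i hi => hA' i (by simp [hi]))
    have hw := hr.lt (fun i hi => hA' i (by simp [hi]))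
    refine ⟨by simpa [List.nodup_append, h.nodup] using fun a b hab he => by rintro rfl; exact h3 (he ▸ hab), ?_, ?_⟩
    · intro g' u' w' hg
      rcases lt_or_ge g' G.length with hlt | hge
      · exact h.lt g' u' w' (by rwa [List.getElem?_append_left hlt] at hg)
      · rw [List.getElem?_append_right hge, List.getElem?_singleton] at hg
        split_ifs at hg with h0
        obtain ⟨rfl, rfl⟩ := Prod.mk.inj (Option.some.inj hg)
        omega
    · intro e he
      rcases List.mem_append.1 he with he | he
      · obtain ⟨l', r', h5, h6, h7⟩ := h.rep e he
        exact ⟨l', r', h5, h6.mono hp, h7.mono hp⟩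
      · obtain rfl := List.mem_singleton.1 he
        exact ⟨l, r, hA, hl.mono hp, hr.mono hp⟩

theorem GatesFor.emit {t : Formula} : ∀ {G : List (ℕ × ℕ)}, GatesFor n A G → t.inner ⊆ A →
    (∀ i ∈ t.leaves, i < n) →
    GatesFor n A (emit n t G).1 ∧ G <+: (Formula.emit n t G).1 ∧
      Rep n (Formula.emit n t G).1 t (Formula.emit n t G).2 := by
  induction t with
  | leaf i => exact fun h _ _ => ⟨h, List.prefix_refl _, rfl⟩
  | node l r hl hr =>
    intro G h hA ht
    obtain ⟨a1, a2, a3⟩ := hl h (fun t h => hA (by simp [h])) (fun i h => ht i (by simp [h]))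
    obtain ⟨b1, b2, b3⟩ := hr a1 (fun t h => hA (by simp [h])) (fun i h => ht i (by simp [h]))
    obtain ⟨c1, c2, c3⟩ := b1.insertGate (hA (by simp)) ht (a3.mono b2) b3
    exact ⟨c1, a2.trans (b2.trans c2), c3⟩

theorem GatesFor.emitAll (ts : List Formula) : ∀ {G : List (ℕ × ℕ)}, GatesFor n A G →
    (∀ t ∈ ts, t.inner ⊆ A ∧ ∀ i ∈ t.leaves, i < n) →
    GatesFor n A (emitAll n ts G).1 ∧ G <+: (Formula.emitAll n ts G).1 ∧
      List.Forall₂ (Rep n (Formula.emitAll n ts G).1) ts (Formula.emitAll n ts G).2 := by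
  induction ts with
  | nil => exact fun h _ => ⟨h, List.prefix_refl _, .nil⟩
  | cons t ts ih =>
    intro G h hA
    obtain ⟨a1, a2, a3⟩ := h.emit (hA t (by simp)).1 (hA t (by simp)).2
    obtain ⟨b1, b2, b3⟩ := ih a1 (fun t h => hA t (by simp [h]))
    exact ⟨b1, a2.trans b2, .cons (a3.mono b2) b3⟩

/-- Every vertex that represents a subformula has a successor, or it represents the whole
formula. -/
theorem Rep.inner_used (hG : G.Nodup) {y : Formula} : ∀ {v w : ℕ} {t : Formula}, Rep n G y v →
    (t ∈ y.inner ∨ ∃ i ∈ y.leaves, t = leaf i) → Rep n G t w →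
    w = v ∨ ∃ e ∈ G, e.1 = w ∨ e.2 = w := by
  induction y with
  | leaf i =>
    intro v w t hv ht hw
    simp only [inner_leaf, List.not_mem_nil, leaves_leaf, List.mem_singleton, exists_eq_left,
      false_or] at ht
    subst ht
    exact .inl (hw.unique hG hv)
  | node l r hl hr =>
    intro v w t hv ht hw
    obtain ⟨g, u, u', rfl, hg, h1, h2⟩ := id hv
    have hmem := List.mem_of_getElem? hg
    simp only [inner_node, List.mem_cons, List.mem_append, leaves_node] at ht
    have : t = node l r ∨ (t ∈ l.inner ∨ ∃ i ∈ l.leaves, t = leaf i) ∨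
        (t ∈ r.inner ∨ ∃ i ∈ r.leaves, t = leaf i) := by
      rcases ht with (h | h | h) | ⟨i, h | h, h'⟩
      exacts [.inl h, .inr (.inl (.inl h)), .inr (.inr (.inl h)), .inr (.inl (.inr ⟨i, h, h'⟩)),
        .inr (.inr (.inr ⟨i, h, h'⟩))]
    rcases this with rfl | h | h
    · exact .inl (hw.unique hG hv)
    · rcases hl h1 h hw with rfl | h
      exacts [.inr ⟨_, hmem, .inl rfl⟩, .inr h]
    · rcases hr h2 h hw with rfl | h
      exacts [.inr ⟨_, hmem, .inr rfl⟩, .inr h]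

/-- There are no more gates than formulas which they represent. -/
theorem GatesFor.length_le (h : GatesFor n A G) : G.length ≤ A.length := by
  have hex : ∀ g : Fin G.length, ∃ t ∈ A, Rep n G t (n + g) := by
    intro g
    obtain ⟨l, r, h1, h2, h3⟩ := h.rep _ (List.getElem_mem g.2)
    exact ⟨_, h1, g, _, _, rfl, List.getElem?_eq_getElem g.2, h2, h3⟩
  choose f hf hf' using hex
  have hinj : Function.Injective f := by
    intro g g' hg
    have := (hf' g).unique h.nodup (hg ▸ hf' g')
    exact Fin.ext (by omega)
  have h1 := (List.nodup_ofFn.2 hinj).subperm (l₂ := A) (fun t ht => by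
    obtain ⟨g, rfl⟩ := (List.mem_ofFn' _ _).1 ht
    exact hf g)
  simpa using h1.length_le

end Formula

/-! ### Values of formulas, and circuits obtained from them -/

namespace Formula

variable {α : Type*} {n : ℕ}

/-- Associativity moves all brackets to the left, so that only the sequence of leaves matters;
commutativity is not used. -/
theorem foldl_fold {op : α → α → α} (h : ∀ u v w, op (op u v) w = op u (op v w))
    (inp : ℕ → α) (t : Formula) : ∀ z,
      t.leaves.foldl (fun u i => op u (inp i)) z = op z (t.fold inp op) := by
  induction t with
  | leaf i => intro z; rfl
  | node l r hl hr => intro z; rw [leaves_node, List.foldl_append, hl, hr, fold, h]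

theorem fold_eq_foldl {op : α → α → α} (h : ∀ u v w, op (op u v) w = op u (op v w))
    (inp : ℕ → α) (t : Formula) : ∀ {i : ℕ} {is : List ℕ}, t.leaves = i :: is →
      t.fold inp op = is.foldl (fun u i => op u (inp i)) (inp i) := by
  induction t with
  | leaf j =>
    intro i is hi
    obtain ⟨rfl, rfl⟩ : j = i ∧ is = [] := by simpa [eq_comm] using hi
    rfl
  | node l r hl hr =>
    intro i is hi
    obtain ⟨j, js, hj⟩ := List.exists_cons_of_ne_nil l.leaves_ne_nil
    rw [leaves_node, hj, List.cons_append, List.cons.injEq] at hi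
    obtain ⟨rfl, rfl⟩ := hi
    rw [fold, hl hj, List.foldl_append, foldl_fold h]

theorem prefixValue_eq_foldl (op : α → α → α) (x : Fin n → α) (inp : ℕ → α)
    (hx : ∀ i : Fin n, inp i = x i) : ∀ (i : ℕ) (h : i < n),
      prefixValue op x i h = (List.range i).foldl (fun u j => op u (inp (j + 1))) (inp 0) := by
  intro i
  induction i with
  | zero => intro h; exact (hx ⟨0, h⟩).symm
  | succ i ih =>
    intro h
    rw [prefixValue, ih, List.range_succ, List.foldl_append, ← hx ⟨i + 1, h⟩]
    rfl

theorem fold_eq_prefixValue {op : α → α → α} (h : ∀ u v w, op (op u v) w = op u (op v w))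
    (x : Fin n → α) (inp : ℕ → α) (hx : ∀ i : Fin n, inp i = x i) {t : Formula} {i : ℕ}
    (hi : i < n) (ht : t.leaves = List.range (i + 1)) :
    t.fold inp op = prefixValue op x i hi := by
  rw [List.range_succ_eq_map] at ht
  rw [fold_eq_foldl h inp t ht, prefixValue_eq_foldl op x inp hx, List.foldl_map]

/-- Since α and f are arbitrary, this serves both for the computed values and for the arrival times.
-/
theorem label_of_rep {m : ℕ} (C : Circuit n m) (x : Fin n → α) (inp : ℕ → α)
    (hx : ∀ i : Fin n, inp i = x i) (f : α → α → α) {t : Formula} :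
    ∀ {v : Fin (n + C.gates.length)}, Rep n C.gates t v → (∀ i ∈ t.leaves, i < n) →
      C.label x f v = t.fold inp f := by
  induction t with
  | leaf i =>
    intro v hv ht
    have hv : v.val = i := hv
    have hi := ht i (by simp)
    rw [Circuit.label, dif_pos (by omega), ← hx]
    simp [hv, fold]
  | node l r hl hr =>
    rintro v ⟨g, u, w, hv, hg, h1, h2⟩ ht
    simp only [leaves_node, List.mem_append] at ht
    obtain ⟨hgl, hgg⟩ := List.getElem?_eq_some_iff.1 hg
    have hvg : v.val - n = g := by omega
    rw [Circuit.label, dif_neg (by omega), fold]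
    have hl' := fun hlt => hl (v := ⟨u, hlt⟩) h1 (fun i h => ht i (.inl h))
    have hr' := fun hlt => hr (v := ⟨w, hlt⟩) h2 (fun i h => ht i (.inr h))
    simp only [hvg, hgg, hl', hr']

theorem leaves_infix_of_mem_inner {t y : Formula} (h : t ∈ y.inner) :
    t.leaves <:+: y.leaves := by
  induction y with
  | leaf i => simp at h
  | node l r hl hr =>
    simp only [inner_node, List.mem_cons, List.mem_append] at h
    rcases h with rfl | h | h
    · exact List.infix_refl _
    · exact (hl h).trans (List.prefix_append _ _).isInfix
    · exact (hr h).trans (List.suffix_append _ _).isInfix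

/-- Formulas for the prefixes can be turned into a circuit. -/
theorem exists_circuit (hn : 2 ≤ n) {ts : List Formula} (hlen : ts.length = n)
    (hts : ∀ (i : ℕ) (h : i < ts.length), ts[i].leaves = List.range (i + 1)) :
    ∃ C : Circuit n n, C.gates = (emitAll n ts []).1 ∧
      (List.ofFn fun i => (C.output i).val) = (emitAll n ts []).2 ∧
      (∀ (N : List Formula), (∀ t ∈ ts, t.inner ⊆ N) → C.size ≤ N.length) ∧
      ∀ i : Fin n, Rep n C.gates (ts[i]) (C.output i) := by
  have hlt : ∀ t ∈ ts, ∀ i ∈ t.leaves, i < n := by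
    intro t ht i hi
    obtain ⟨j, hj, rfl⟩ := List.getElem_of_mem ht
    rw [hts j hj, List.mem_range] at hi
    omega
  have h0 : ∀ A, GatesFor n A [] := fun A => ⟨by simp, by simp, by simp⟩
  -- The emitted gates do not depend on N. The list of all inner subformulas yields the circuit
  -- axioms, and an arbitrary N yields the size bound.
  have hemit := fun (N : List Formula) (hN : ∀ t ∈ ts, t.inner ⊆ N) =>
    (h0 N).emitAll ts (fun t ht => ⟨hN t ht, hlt t ht⟩)
  have hsub : ∀ t ∈ ts, t.inner ⊆ (ts.map inner).flatten := fun t ht s hs =>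
    List.mem_flatten.2 ⟨_, List.mem_map_of_mem ht, hs⟩
  obtain ⟨hG, -, hrep⟩ := hemit _ hsub
  have hsize := fun N hN => (hemit N hN).1.length_le
  revert hG hrep hsize
  generalize (emitAll n ts []).1 = G
  generalize (emitAll n ts []).2 = outs
  intro hG hrep hsize
  have hol : ts.length = outs.length := hrep.length_eq
  have hr : ∀ (i : ℕ) (h : i < n), Rep n G ts[i] outs[i] := fun i h =>
    hrep.get (by omega) (by omega)
  have hused : ∀ (i : ℕ) (h : i < n) (w : ℕ) (t : Formula),
      (t ∈ ts[i].inner ∨ ∃ j ∈ ts[i].leaves, t = leaf j) → Rep n G t w →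
      w = outs[i] ∨ ∃ e ∈ G, e.1 = w ∨ e.2 = w :=
    fun i h w t ht hw => (hr i h).inner_used hG.nodup ht hw
  refine ⟨⟨G, fun i => ⟨outs[i], (hr i i.2).lt (hlt _ (List.getElem_mem _))⟩, ?_, ?_, ?_, ?_⟩,
    rfl, ?_, hsize, fun i => hr i i.2⟩
  · exact fun g h => hG.lt g _ _ (List.getElem?_eq_getElem h)
  · intro e he heq
    -- Equal predecessors would force l and r to have the same nonempty list of leaves, but the
    -- leaves of an output formula do not repeat.
    obtain ⟨l, r, h1, h2, h3⟩ := hG.rep e he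
    obtain ⟨L, hL, h4⟩ := List.mem_flatten.1 h1
    obtain ⟨y, hy, rfl⟩ := List.mem_map.1 hL
    have h5 := leaves_infix_of_mem_inner h4
    have h6 : (node l r).leaves.Nodup := by
      refine h5.sublist.nodup ?_
      obtain ⟨j, hj, rfl⟩ := List.getElem_of_mem hy
      rw [hts j hj]
      exact List.nodup_range
    have h7 : ∀ i ∈ (node l r).leaves, i < n := fun i hi => hlt y hy i (h5.subset hi)
    rw [leaves_node] at h6 h7
    rw [← heq] at h3
    have h8 := Rep.leaves_eq (fun i hi => h7 i (List.mem_append_left _ hi))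
      (fun i hi => h7 i (List.mem_append_right _ hi)) h2 h3
    obtain ⟨i, is, hi⟩ := List.exists_cons_of_ne_nil r.leaves_ne_nil
    rw [h8, hi] at h6
    simp at h6
  · intro v hv
    -- The last output formula contains every input. As n ≥ 2, it is not a leaf, so its vertex is a
    -- gate and differs from v.
    have hl := hts (n - 1) (by omega)
    have h1 := hused (n - 1) (by omega) v (leaf v)
      (.inr ⟨v, by rw [hl, List.mem_range]; omega, rfl⟩) rfl
    refine h1.resolve_left ?_
    intro hv'
    have h2 := hr (n - 1) (by omega)
    revert h2 hl
    generalize ts[n - 1] = t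
    intro hl h2
    cases t with
    | leaf i =>
      have := congrArg List.length hl
      simp at this
      omega
    | node l r =>
      obtain ⟨g, _, _, hg, -⟩ := h2
      omega
  · intro v hv
    -- Every vertex represents a subformula of some output formula; hence it has a successor or is
    -- that output.
    have hcase : ∃ (i : ℕ) (h : i < n) (t : Formula),
        (t ∈ ts[i].inner ∨ ∃ j ∈ ts[i].leaves, t = leaf j) ∧ Rep n G t v := by
      rcases lt_or_ge v.val n with h | h
      · exact ⟨v, h, leaf v, .inr ⟨v, by rw [hts _ (by omega)]; simp, rfl⟩, rfl⟩
      · have hg : v.val - n < G.length := by omega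
        obtain ⟨l, r, h1, h2, h3⟩ := hG.rep _ (List.getElem_mem hg)
        obtain ⟨L, hL, h4⟩ := List.mem_flatten.1 h1
        obtain ⟨y, hy, rfl⟩ := List.mem_map.1 hL
        obtain ⟨j, hj, rfl⟩ := List.getElem_of_mem hy
        exact ⟨j, by omega, _, .inl h4, v - n, _, _, by omega, List.getElem?_eq_getElem hg,
          h2, h3⟩
    obtain ⟨i, h, t, ht, hw⟩ := hcase
    rcases hused i h v t ht hw with h1 | ⟨e, he, h1⟩
    · exact ⟨⟨i, h⟩, Fin.ext h1.symm⟩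
    · have := hv e he
      omega
  · refine List.ext_getElem (by simp; omega) fun i h1 h2 => ?_
    simp

/-- The list of the inputs with numbers from `i` on. -/
def inputs (i : ℕ) : ℕ → List Formula
  | 0 => []
  | k + 1 => leaf i :: inputs (i + 1) k

theorem inputs_eq_map (k : ℕ) : ∀ i, inputs i k = (List.range' i k).map leaf := by
  induction k with
  | zero => intro i; rfl
  | succ k ih => intro i; simp [inputs, ih, List.range'_succ]

/-- The prefix circuits: their gates and outputs come from the prefix construction, and they have
the claimed delay and size. -/
theorem exists_prefix_circuit (hn : 3 ≤ n) (a : Fin n → ℕ) (a' : ℕ → ℕ)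
    (ha : ∀ i : Fin n, a' i = a i) :
    ∃ C : Circuit n n,
      C.gates = (emitAll n (prefixes a' n (inputs 0 n)) []).1 ∧
      (List.ofFn fun i => (C.output i).val) = (emitAll n (prefixes a' n (inputs 0 n)) []).2 ∧
      (∀ op : Bool → Bool → Bool,
        (∀ u v w : Bool, op (op u v) w = op u (op v w)) → C.SolvesPrefix op) ∧
      (C.delay a : ℝ) ≤
        Real.logb 2 (weight a) + 3 * Real.logb 2 (Real.logb 2 n) + 0.007 ∧
      (C.size : ℝ) ≤ 3.114 * n * Real.logb 2 (Real.logb 2 n) := by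
  have hin : inputs 0 n = (List.range n).map leaf := by rw [inputs_eq_map, List.range_eq_range']
  have hl : (inputs 0 n).length = n := by rw [hin]; simp
  have hlen := length_prefixes (a := a') (k := n) (xs := inputs 0 n) (by omega)
  have hsc := map_leaves_prefixes a' n (inputs 0 n) (by omega)
  have hleaves : ∀ (i : ℕ) (h : i < (prefixes a' n (inputs 0 n)).length),
      (prefixes a' n (inputs 0 n))[i].leaves = List.range (i + 1) := by
    intro i h
    have h1 : (prefixes a' n (inputs 0 n))[i].leaves =
        ((prefixes a' n (inputs 0 n)).map leaves)[i]'(by simpa using h) := by simp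
    rw [h1]
    simp only [hsc, getElem_scanWords, List.nil_append]
    rw [hin, ← List.map_take, ← List.map_take, List.take_range, List.map_map,
      min_eq_left (by omega)]
    have : (leaves ∘ leaf) = fun i => [i] := rfl
    rw [this, ← List.flatMap_def]
    simp
  have hdel := time_prefixes_le a' n (inputs 0 n) (by omega)
  obtain ⟨N, hN, hN'⟩ := adds_prefixes a' n (inputs 0 n) (by omega)
  have hw : weights a' (inputs 0 n) = weight a := by
    rw [weight, weights, hin, List.map_map, Finset.sum_congr rfl fun i _ => by rw [← ha i],
      Fin.sum_univ_eq_sum_range (fun i => 2 ^ a' i), Finset.sum_range, ← List.sum_ofFn]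
    congr 1
    rw [List.ofFn_eq_map, ← List.map_coe_finRange_eq_range, List.map_map]
    rfl
  rw [hw, hl] at hdel
  rw [hl] at hN hlen
  obtain ⟨C, h1, h2, h3, h4⟩ := exists_circuit (by omega) hlen hleaves
  have hlt : ∀ i : Fin n, ∀ j ∈ ((prefixes a' n (inputs 0 n))[i]).leaves, j < n := by
    intro i j hj
    have := i.2
    rw [Fin.getElem_fin, hleaves, List.mem_range] at hj
    omega
  refine ⟨C, h1, h2, ?_, ?_, ?_⟩
  · intro op hop x i
    have hx : ∃ inp : ℕ → Bool, ∀ i : Fin n, inp i = x i :=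
      ⟨fun j => if h : j < n then x ⟨j, h⟩ else false, by simp⟩
    obtain ⟨inp, hx⟩ := hx
    rw [Circuit.value, label_of_rep C x inp hx op (h4 i) (hlt i)]
    exact fold_eq_prefixValue hop x inp hx i.2 (hleaves i (by omega))
  · have hne : (Finset.univ : Finset (Fin n)).Nonempty := ⟨⟨0, by omega⟩, Finset.mem_univ _⟩
    obtain ⟨i, -, hi⟩ := Finset.exists_mem_eq_sup _ hne fun i : Fin n => C.arrival a (C.output i)
    have h5 := hdel _ (List.getElem_mem (show i.val < _ by omega))
    rw [Circuit.delay, hi, Circuit.arrival, label_of_rep C a a' ha _ (h4 i) (hlt i)]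
    have hW : 0 < (weight a : ℝ) := by
      have : 0 < weight a := Finset.sum_pos (fun i _ => by positivity) hne
      exact_mod_cast this
    rw [delayFactor_eq_rpow hn] at h5
    have h6 := logb_two_mono (by positivity) h5
    rw [Real.logb_pow, Real.logb_self_eq_one (by norm_num), mul_one,
      Real.logb_mul (by positivity) (by positivity), Real.logb_rpow (by norm_num) (by norm_num)] at h6
    have h7 : (prefixes a' n (inputs 0 n))[i].fold a' (fun s t => max s t + 1) =
      (prefixes a' n (inputs 0 n))[i.val].time a' := rfl
    rw [h7]
    linarith
  -- The starting formulas are leaves without inner subformulas, so N contains everything that is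
  -- built.
  · have hsub : ∀ t ∈ prefixes a' n (inputs 0 n), t.inner ⊆ N := by
      intro t ht s hs
      refine (hN' t ht s hs).resolve_right ?_
      rintro ⟨x, hx, hs⟩
      rw [hin] at hx
      obtain ⟨j, -, rfl⟩ := List.mem_map.1 hx
      simp at hs
    have h5 : (C.size : ℝ) ≤ N.length := by exact_mod_cast h3 N hsub
    have h6 := sizeBound_le_mul n
    rw [sizeRate, max_eq_left hn] at h6
    linarith

end Formula

/-! ### Reasoning about programs -/

/-- Function `f` of the program `P` maps `u` to `v` within `T` steps. -/
def Program.Fn (P : Program) (f : ℕ) (u v : Val) (T : ℕ) : Prop :=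
  ∃ body, P[f]? = some body ∧ ∃ t ≤ T, Steps P [u] body v t

/-- Continue with a number. -/
def Val.onNum (Q : ℕ → Prop) : Val → Prop
  | .num k => Q k
  | .pair _ _ => False

/-- A sufficient condition for the evaluation of `e` to end with a value and a number of steps
that satisfy `Q`. -/
def Expr.wp (P : Program) : Expr → List Val → (Val → ℕ → Prop) → Prop
  | .var i, env, Q => ∃ v, env[i]? = some v ∧ Q v 1
  | .lit k, _, Q => Q (.num k) 1
  | .add e₁ e₂, env, Q => e₁.wp P env fun v₁ t₁ => v₁.onNum fun k₁ =>
      e₂.wp P env fun v₂ t₂ => v₂.onNum fun k₂ => Q (.num (k₁ + k₂)) (t₁ + t₂ + 1)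
  | .sub e₁ e₂, env, Q => e₁.wp P env fun v₁ t₁ => v₁.onNum fun k₁ =>
      e₂.wp P env fun v₂ t₂ => v₂.onNum fun k₂ => Q (.num (k₁ - k₂)) (t₁ + t₂ + 1)
  | .ifLe e₁ e₂ e₃ e₄, env, Q => e₁.wp P env fun v₁ t₁ => v₁.onNum fun k₁ =>
      e₂.wp P env fun v₂ t₂ => v₂.onNum fun k₂ =>
        (k₁ ≤ k₂ → e₃.wp P env fun v t => Q v (t₁ + t₂ + t + 1)) ∧
        (k₂ < k₁ → e₄.wp P env fun v t => Q v (t₁ + t₂ + t + 1))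
  | .pair e₁ e₂, env, Q => e₁.wp P env fun v₁ t₁ => e₂.wp P env fun v₂ t₂ =>
      Q (.pair v₁ v₂) (t₁ + t₂ + 1)
  | .cases e e₁ e₂, env, Q => e.wp P env fun u s =>
      match u with
      | .num k => e₁.wp P (.num k :: env) fun v t => Q v (s + t + 1)
      | .pair a b => e₂.wp P (a :: b :: env) fun v t => Q v (s + t + 1)
  | .letIn e₁ e₂, env, Q => e₁.wp P env fun u s => e₂.wp P (u :: env) fun v t => Q v (s + t + 1)
  | .call f e, env, Q => e.wp P env fun u s =>
      ∃ v T, P.Fn f u v T ∧ ∀ t ≤ T, Q v (s + t + 1)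

/-- For a call only an upper bound T on the cost is known, so `Expr.wp` demands the postcondition
for all t ≤ T; everywhere else step counts are exact. -/
theorem Expr.wp_sound {P : Program} (e : Expr) : ∀ {env : List Val} {Q : Val → ℕ → Prop},
    e.wp P env Q → ∃ v t, Steps P env e v t ∧ Q v t := by
  induction e with
  | var i => rintro env Q ⟨v, h, hQ⟩; exact ⟨v, 1, .var h, hQ⟩
  | lit k => intro env Q h; exact ⟨_, 1, .lit, h⟩
  | add e₁ e₂ h₁ h₂ =>
    intro env Q h
    obtain ⟨v₁ | _, t₁, s₁, h⟩ := h₁ h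
    · obtain ⟨v₂ | _, t₂, s₂, h⟩ := h₂ h
      · exact ⟨_, _, .add s₁ s₂, h⟩
      · exact h.elim
    · exact h.elim
  | sub e₁ e₂ h₁ h₂ =>
    intro env Q h
    obtain ⟨v₁ | _, t₁, s₁, h⟩ := h₁ h
    · obtain ⟨v₂ | _, t₂, s₂, h⟩ := h₂ h
      · exact ⟨_, _, .sub s₁ s₂, h⟩
      · exact h.elim
    · exact h.elim
  | ifLe e₁ e₂ e₃ e₄ h₁ h₂ h₃ h₄ =>
    intro env Q h
    obtain ⟨k₁ | _, t₁, s₁, h⟩ := h₁ h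
    · obtain ⟨k₂ | _, t₂, s₂, h⟩ := h₂ h
      · rcases le_or_gt k₁ k₂ with hk | hk
        · obtain ⟨v, t, s, h⟩ := h₃ (h.1 hk)
          exact ⟨_, _, .ifLe_true s₁ s₂ hk s, h⟩
        · obtain ⟨v, t, s, h⟩ := h₄ (h.2 hk)
          exact ⟨_, _, .ifLe_false s₁ s₂ hk s, h⟩
      · exact h.elim
    · exact h.elim
  | pair e₁ e₂ h₁ h₂ =>
    intro env Q h
    obtain ⟨v₁, t₁, s₁, h⟩ := h₁ h
    obtain ⟨v₂, t₂, s₂, h⟩ := h₂ h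
    exact ⟨_, _, .pair s₁ s₂, h⟩
  | cases e e₁ e₂ h₀ h₁ h₂ =>
    intro env Q h
    obtain ⟨_ | _, t₀, s₀, h⟩ := h₀ h
    · obtain ⟨v, t, s, h⟩ := h₁ h
      exact ⟨_, _, .cases_num s₀ s, h⟩
    · obtain ⟨v, t, s, h⟩ := h₂ h
      exact ⟨_, _, .cases_pair s₀ s, h⟩
  | letIn e₁ e₂ h₁ h₂ =>
    intro env Q h
    obtain ⟨v₁, t₁, s₁, h⟩ := h₁ h
    obtain ⟨v₂, t₂, s₂, h⟩ := h₂ h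
    exact ⟨_, _, .letIn s₁ s₂, h⟩
  | call f e h₀ =>
    intro env Q h
    obtain ⟨u, s, hs, v, T, ⟨body, hb, t, ht, hst⟩, hQ⟩ := h₀ h
    exact ⟨_, _, .call hb hs hst, hQ t ht⟩

theorem Program.Fn.of_wp {P : Program} {f : ℕ} {u v : Val} {T : ℕ} (body : Expr)
    (hb : P[f]? = some body) (h : body.wp P [u] fun w t => w = v ∧ t ≤ T) : P.Fn f u v T := by
  obtain ⟨w, t, hs, rfl, ht⟩ := Expr.wp_sound body h
  exact ⟨body, hb, t, ht, hs⟩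

theorem Program.Fn.mono {P : Program} {f : ℕ} {u v : Val} {T T' : ℕ} (h : P.Fn f u v T)
    (hT : T ≤ T') : P.Fn f u v T' := by
  obtain ⟨body, hb, t, ht, hs⟩ := h
  exact ⟨body, hb, t, ht.trans hT, hs⟩

/-! ### The program text -/

namespace PrefixProgram

open Expr

/-- Split a pair. -/
abbrev unpair (e e' : Expr) : Expr := .cases e (.lit 0) e'

/-- Build a formula with its arrival time. -/
def nodeBody : Expr :=
  unpair (var 0) <| unpair (var 0) <| unpair (var 3) <|
    .ifLe (var 0) (var 2) (.pair (.add (var 2) (.lit 1)) (var 6))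
      (.pair (.add (var 0) (.lit 1)) (var 6))

/-- Push a formula on a stack, combining formulas at equal levels. -/
def carryBody : Expr :=
  unpair (var 0) <| .cases (var 1) (.pair (var 1) (var 2)) <|
    unpair (var 0) <| unpair (var 4) <|
      .ifLe (var 3) (var 1)
        (.call 2 (.pair (.pair (.call 1 (.pair (var 0) (var 2))) (.add (var 1) (.lit 1))) (var 5)))
        (.pair (var 6) (var 7))

/-- Combine a formula with the entries of a stack below a level. -/
def sinkBody : Expr :=
  unpair (var 0) <| .cases (var 1) (.pair (var 1) (var 2)) <|
    unpair (var 0) <| unpair (var 4) <|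
      .ifLe (var 1) (var 3) (.call 2 (var 8))
        (.call 3 (.pair (.pair (.call 1 (.pair (var 0) (var 2))) (var 1)) (var 5)))

/-- Push all formulas of a list on a stack. -/
def stackBody : Expr :=
  .cases (var 0) (.lit 0) <| .letIn (.call 4 (var 1)) <| unpair (var 1) <|
    .cases (var 2) (.pair (.pair (var 4) (var 1)) (.lit 0)) <|
      unpair (var 0) <|
        .ifLe (var 4) (var 1) (.call 2 (.pair (.pair (var 7) (var 4)) (var 6)))
          (.call 2 (.pair (.pair (var 7) (var 4)) (.call 3 (.pair (.pair (var 0) (var 4)) (var 3)))))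

/-- Combine a formula with all entries of a stack. -/
def collapseBody : Expr :=
  unpair (var 0) <| .cases (var 1) (var 1) <| unpair (var 0) <|
    .call 5 (.pair (.call 1 (.pair (var 4) (var 0))) (var 3))

/-- Combine all formulas of a list. -/
def combineBody : Expr :=
  unpair (.call 4 (var 0)) <| unpair (var 0) <| .call 5 (.pair (var 0) (var 3))

/-- The block length for the length of a list. -/
def rootBody : Expr :=
  unpair (var 0) <| .cases (var 0) (unpair (var 2) (var 0)) <| unpair (var 3) <|
    .ifLe (var 1) (.lit 0)
      (.call 7 (.pair (var 3)
        (.pair (.add (var 0) (.lit 1)) (.add (.add (var 0) (var 0)) (.lit 1)))))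
      (.call 7 (.pair (var 3) (.pair (var 0) (.sub (var 1) (.lit 1)))))

/-- Split a list after a given number of entries. -/
def splitBody : Expr :=
  unpair (var 0) <| .ifLe (var 0) (.lit 0) (.pair (.lit 0) (var 1)) <|
    .cases (var 1) (.pair (.lit 0) (.lit 0)) <|
      unpair (.call 8 (.pair (.sub (var 2) (.lit 1)) (var 1))) <|
        .pair (.pair (var 2) (var 0)) (var 1)

/-- Combine the blocks of a list except the last one. -/
def headsBody : Expr :=
  unpair (var 0) <| unpair (.call 8 (var 2)) <|
    .cases (var 1) (.lit 0) <|
      .pair (.call 6 (var 2)) (.call 9 (.pair (var 4) (var 3)))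

/-- Combine the prefixes inside the blocks with the prefixes of blocks. -/
def distributeBody : Expr :=
  unpair (var 0) <| unpair (var 1) <| .cases (var 0) (.lit 0) <|
    unpair (.call 8 (.pair (var 4) (var 3))) <|
      .call 11 (.pair (var 2) (.pair (.call 13 (var 0))
        (.call 10 (.pair (var 6) (.pair (var 3) (var 1))))))

/-- Combine a formula with all formulas of a list, and append another list. -/
def mapNodeBody : Expr :=
  unpair (var 0) <| unpair (var 1) <| .cases (var 0) (var 2) <|
    .pair (.call 1 (.pair (var 4) (var 0))) (.call 11 (.pair (var 4) (.pair (var 1) (var 3))))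

/-- Append two lists. -/
def appendBody : Expr :=
  unpair (var 0) <| .cases (var 0) (var 2) <|
    .pair (var 0) (.call 12 (.pair (var 1) (var 3)))

/-- Formulas for all prefixes. -/
def prefixesBody : Expr :=
  .cases (var 0) (var 1) <| .cases (var 1) (var 3) <|
    .letIn (.call 7 (.pair (var 4) (.pair (.lit 0) (.lit 0)))) <|
      unpair (.call 8 (.pair (var 0) (var 5))) <|
        .call 12 (.pair (.call 13 (var 0)) (.call 10 (.pair (var 2)
          (.pair (.call 13 (.call 9 (.pair (var 2) (var 7)))) (var 1)))))

/-- Find or append a gate. -/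
def insertBody : Expr :=
  unpair (var 0) <| unpair (var 1) <|
    .cases (var 1) (.pair (.pair (var 3) (.lit 0)) (var 1)) <|
      unpair (var 0) <| unpair (var 6) <|
        .ifLe (.add (.add (.sub (var 0) (var 2)) (.sub (var 2) (var 0)))
            (.add (.sub (var 1) (var 3)) (.sub (var 3) (var 1)))) (.lit 0)
          (.pair (var 7) (var 6)) <|
          unpair (.call 14 (.pair (var 8) (.pair (.add (var 6) (.lit 1)) (var 5)))) <|
            .pair (.pair (var 6) (var 0)) (var 1)

/-- Add the gates of a formula. -/
def emitBody : Expr :=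
  unpair (var 0) <| unpair (var 0) <| .cases (var 1) (unpair (var 4) (.pair (var 1) (var 2))) <|
    unpair (.call 15 (.pair (var 0) (var 5))) <| unpair (var 7) <|
      unpair (.call 15 (.pair (var 5) (.pair (var 0) (var 2)))) <|
        .call 14 (.pair (.pair (var 5) (var 1)) (.pair (var 2) (var 0)))

/-- Add the gates of a list of formulas. -/
def emitAllBody : Expr :=
  unpair (var 0) <| unpair (var 1) <| .cases (var 2) (.pair (var 2) (.lit 0)) <|
    unpair (.call 15 (.pair (var 0) (.pair (var 2) (var 3)))) <|
      unpair (.call 16 (.pair (var 3) (.pair (var 4) (var 0)))) <|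
        .pair (var 0) (.pair (var 3) (var 1))

/-- Formulas for the inputs with given arrival times. -/
def inputsBody : Expr :=
  unpair (var 0) <| .cases (var 1) (.lit 0) <|
    .pair (.pair (var 0) (var 2)) (.call 17 (.pair (.add (var 2) (.lit 1)) (var 1)))

/-- The length of a list. -/
def lengthBody : Expr :=
  .cases (var 0) (.lit 0) (.add (.call 18 (var 1)) (.lit 1))

/-- Construct the circuit for given arrival times. -/
def mainBody : Expr :=
  .call 16 (.pair (.call 13 (.call 17 (.pair (.lit 0) (var 0))))
    (.pair (.call 18 (var 0)) (.lit 0)))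

end PrefixProgram

open PrefixProgram in
/-- The program that constructs the prefix circuits. -/
def prefixProgram : Program :=
  [mainBody, nodeBody, carryBody, sinkBody, stackBody, collapseBody, combineBody, rootBody,
    splitBody, headsBody, distributeBody, mapNodeBody, appendBody, prefixesBody, insertBody,
    emitBody, emitAllBody, inputsBody, lengthBody]

set_option linter.unusedSimpArgs false

/-! ### Encodings, and step counts for the functions of the program -/

namespace Formula

/-- A formula as a value; every subformula comes with its arrival time. -/
def enc (a : ℕ → ℕ) : Formula → Val
  | leaf i => .pair (.num (a i)) (.num i)
  | node l r => .pair (.num ((node l r).time a)) (.pair (l.enc a) (r.enc a))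

/-- A list of formulas as a value. -/
def encList (a : ℕ → ℕ) (xs : List Formula) : Val := .ofList (xs.map (enc a))

/-- A stack as a value. -/
def encStack (a : ℕ → ℕ) (st : List (Formula × ℕ)) : Val :=
  .ofList (st.map fun p => .pair (p.1.enc a) (.num p.2))

/-- A list of gates as a value. -/
def encGates (G : List (ℕ × ℕ)) : Val := .ofList (G.map fun e => .pair (.num e.1) (.num e.2))

/-- The part of the value of a formula that follows its arrival time. -/
def encBody (a : ℕ → ℕ) : Formula → Val
  | leaf i => .num i
  | node l r => .pair (l.enc a) (r.enc a)

/-- The arrival time is stored in front, so the program reads it in constant time without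
distinguishing leaves from nodes. -/
theorem enc_eq (a : ℕ → ℕ) (t : Formula) : t.enc a = .pair (.num (t.time a)) (t.encBody a) := by
  cases t <;> rfl

@[simp] theorem encList_nil (a : ℕ → ℕ) : encList a [] = .num 0 := rfl
@[simp] theorem encList_cons (a : ℕ → ℕ) (x : Formula) (xs : List Formula) :
    encList a (x :: xs) = .pair (x.enc a) (encList a xs) := rfl
@[simp] theorem encStack_nil (a : ℕ → ℕ) : encStack a [] = .num 0 := rfl
@[simp] theorem encStack_cons (a : ℕ → ℕ) (u : Formula) (s : ℕ) (st : List (Formula × ℕ)) :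
    encStack a ((u, s) :: st) = .pair (.pair (u.enc a) (.num s)) (encStack a st) := rfl
@[simp] theorem encGates_nil : encGates [] = .num 0 := rfl
@[simp] theorem encGates_cons (e : ℕ × ℕ) (G : List (ℕ × ℕ)) :
    encGates (e :: G) = .pair (.pair (.num e.1) (.num e.2)) (encGates G) := rfl

open PrefixProgram

/-- This is the pattern of the `fn_` lemmas: the body is executed symbolically by unfolding
`Expr.wp`, calls are discharged by earlier lemmas or by induction, and arithmetic closes the count.
The constants are generous. -/
theorem fn_node (a : ℕ → ℕ) (l r : Formula) :
    prefixProgram.Fn 1 (.pair (l.enc a) (r.enc a)) ((node l r).enc a) 20 := by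
  refine .of_wp nodeBody rfl ?_
  have h : (node l r).enc a = .pair (.num (max (l.time a) (r.time a) + 1))
      (.pair (l.enc a) (r.enc a)) := rfl
  rw [h, enc_eq a l, enc_eq a r]
  simp only [nodeBody, Expr.wp, Val.onNum, List.getElem?_cons_zero, List.getElem?_cons_succ, Option.some.injEq,
    exists_eq_left']
  constructor <;> intro h
  · rw [max_eq_left h]; exact ⟨rfl, by omega⟩
  · rw [max_eq_right h.le]; exact ⟨rfl, by omega⟩

theorem fn_carry (a : ℕ → ℕ) (st : List (Formula × ℕ)) : ∀ (u : Formula) (t : ℕ),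
    prefixProgram.Fn 2 (.pair (.pair (u.enc a) (.num t)) (encStack a st))
      (encStack a (carry u t st)) (50 * st.length + 50) := by
  induction st with
  | nil =>
    intro u t
    refine .of_wp carryBody rfl ?_
    simp only [carryBody, carry, encStack_nil, encStack_cons, Expr.wp, Val.onNum, List.getElem?_cons_zero, List.getElem?_cons_succ, Option.some.injEq,
    exists_eq_left']
    exact ⟨trivial, by omega⟩
  | cons p st ih =>
    obtain ⟨v, s⟩ := p
    intro u t
    refine .of_wp carryBody rfl ?_
    simp only [carryBody, carry, encStack_cons, List.length_cons, Expr.wp, Val.onNum, List.getElem?_cons_zero, List.getElem?_cons_succ, Option.some.injEq,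
    exists_eq_left']
    constructor <;> intro h
    · refine ⟨_, _, fn_node a u v, fun t₁ h₁ => ⟨_, _, ih (node u v) (t + 1), fun t₂ h₂ => ?_⟩⟩
      rw [if_pos h]
      exact ⟨rfl, by omega⟩
    · rw [if_neg (by omega)]
      exact ⟨rfl, by omega⟩

theorem fn_sink (a : ℕ → ℕ) (st : List (Formula × ℕ)) : ∀ (u : Formula) (t : ℕ),
    prefixProgram.Fn 3 (.pair (.pair (u.enc a) (.num t)) (encStack a st))
      (encStack a (sink u t st)) (50 * st.length + 100) := by
  induction st with
  | nil =>
    intro u t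
    refine .of_wp sinkBody rfl ?_
    simp only [sinkBody, sink, encStack_nil, encStack_cons, Expr.wp, Val.onNum, List.getElem?_cons_zero, List.getElem?_cons_succ, Option.some.injEq,
    exists_eq_left']
    exact ⟨trivial, by omega⟩
  | cons p st ih =>
    obtain ⟨v, s⟩ := p
    intro u t
    refine .of_wp sinkBody rfl ?_
    simp only [sinkBody, sink, encStack_cons, List.length_cons, Expr.wp, Val.onNum, List.getElem?_cons_zero, List.getElem?_cons_succ, Option.some.injEq,
    exists_eq_left']
    constructor <;> intro h
    · refine ⟨_, _, fn_carry a ((v, s) :: st) u t, fun t₁ h₁ => ?_⟩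
      rw [if_pos h]
      rw [List.length_cons] at h₁
      exact ⟨rfl, by omega⟩
    · refine ⟨_, _, fn_node a u v, fun t₁ h₁ => ⟨_, _, ih (node u v) t, fun t₂ h₂ => ?_⟩⟩
      rw [if_neg (by omega)]
      exact ⟨rfl, by omega⟩

theorem length_carry_le (st : List (Formula × ℕ)) : ∀ (u : Formula) (t : ℕ),
    (carry u t st).length ≤ st.length + 1 := by
  induction st with
  | nil => intro u t; simp [carry]
  | cons p st ih =>
    intro u t
    rw [carry]
    split_ifs
    · exact (ih _ _).trans (by simp)
    · simp

theorem length_sink_le (st : List (Formula × ℕ)) : ∀ (u : Formula) (t : ℕ),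
    (sink u t st).length ≤ st.length + 1 := by
  induction st with
  | nil => intro u t; simp [sink]
  | cons p st ih =>
    intro u t
    rw [sink]
    split_ifs
    · exact length_carry_le _ _ _
    · exact (ih _ _).trans (by simp)

theorem length_stack_le (a : ℕ → ℕ) (xs : List Formula) : (stack a xs).length ≤ xs.length := by
  induction xs with
  | nil => simp [stack]
  | cons x xs ih =>
    rw [stack]
    revert ih
    generalize stack a xs = st
    intro ih
    cases st with
    | nil => simp [push]
    | cons p st =>
      rw [push, List.length_cons]
      split_ifs
      · exact (length_carry_le _ _ _).trans (Nat.succ_le_succ ih)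
      · exact (length_carry_le _ _ _).trans
          ((Nat.succ_le_succ (length_sink_le _ _ _)).trans (by simpa using ih))

theorem fn_stack (a : ℕ → ℕ) (xs : List Formula) :
    prefixProgram.Fn 4 (encList a xs) (encStack a (stack a xs))
      (200 * xs.length * xs.length + 200 * xs.length + 10) := by
  induction xs with
  | nil =>
    refine .of_wp stackBody rfl ?_
    simp only [stackBody, stack, encList_nil, encStack_nil, Expr.wp, Val.onNum, List.getElem?_cons_zero, List.getElem?_cons_succ, Option.some.injEq,
    exists_eq_left']
    exact ⟨trivial, by omega⟩
  | cons x xs ih =>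
    refine .of_wp stackBody rfl ?_
    have hl := length_stack_le a xs
    simp only [stackBody, stack, encList_cons, List.length_cons, Expr.wp, Val.onNum, List.getElem?_cons_zero, List.getElem?_cons_succ, Option.some.injEq,
    exists_eq_left']
    refine ⟨_, _, ih, fun t₁ h₁ => ?_⟩
    -- One push runs at most once through a stack no longer than the list in `sink` and once in
    -- `carry`, each at 50 steps per entry.
    have hb : t₁ + 100 * xs.length + 250 ≤
      200 * (xs.length + 1) * (xs.length + 1) + 200 * (xs.length + 1) + 10 := by nlinarith
    rw [enc_eq a x]
    revert hl
    generalize stack a xs = st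
    intro hl
    cases st with
    | nil =>
      simp only [encStack_nil, encStack_cons, push, enc_eq a x, Expr.wp, Val.onNum, List.getElem?_cons_zero, List.getElem?_cons_succ, Option.some.injEq,
    exists_eq_left']
      exact ⟨trivial, by omega⟩
    | cons p st =>
      obtain ⟨u, s⟩ := p
      have hc := fn_carry a ((u, s) :: st) x (x.time a)
      have hs := fn_sink a st u (x.time a)
      have hc' := fn_carry a (sink u (x.time a) st) x (x.time a)
      have hl' := length_sink_le st u (x.time a)
      simp only [List.length_cons] at hl
      rw [encStack_cons, enc_eq a x, List.length_cons] at hc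
      rw [enc_eq a x] at hc'
      simp only [encStack_cons, push, Expr.wp, Val.onNum, List.getElem?_cons_zero, List.getElem?_cons_succ, Option.some.injEq,
    exists_eq_left']
      constructor <;> intro h
      · refine ⟨_, _, hc, fun t₂ h₂ => ?_⟩
        rw [if_pos h]
        exact ⟨rfl, by omega⟩
      · refine ⟨_, _, hs, fun t₂ h₂ => ⟨_, _, hc', fun t₃ h₃ => ?_⟩⟩
        rw [if_neg (by omega)]
        exact ⟨rfl, by omega⟩

theorem fn_collapse (a : ℕ → ℕ) (st : List (Formula × ℕ)) : ∀ u : Formula,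
    prefixProgram.Fn 5 (.pair (u.enc a) (encStack a st)) ((collapse u st).enc a)
      (50 * st.length + 20) := by
  induction st with
  | nil =>
    intro u
    refine .of_wp collapseBody rfl ?_
    simp only [collapseBody, collapse, encStack_nil, Expr.wp, Val.onNum, List.getElem?_cons_zero, List.getElem?_cons_succ, Option.some.injEq,
    exists_eq_left']
    exact ⟨trivial, by omega⟩
  | cons p st ih =>
    obtain ⟨v, s⟩ := p
    intro u
    refine .of_wp collapseBody rfl ?_
    simp only [collapseBody, collapse, encStack_cons, List.length_cons, Expr.wp, Val.onNum, List.getElem?_cons_zero, List.getElem?_cons_succ, Option.some.injEq,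
    exists_eq_left']
    exact ⟨_, _, fn_node a u v, fun t₁ h₁ => ⟨_, _, ih (node u v), fun t₂ h₂ =>
      ⟨rfl, by omega⟩⟩⟩

theorem fn_combine (a : ℕ → ℕ) {xs : List Formula} (hx : xs ≠ []) :
    prefixProgram.Fn 6 (encList a xs) ((combine a xs).enc a)
      (200 * xs.length * xs.length + 300 * xs.length + 50) := by
  refine .of_wp combineBody rfl ?_
  have hs := fn_stack a xs
  have hl := length_stack_le a xs
  have hso := stackOf_stack a xs
  simp only [combineBody, combine, Expr.wp, Val.onNum, List.getElem?_cons_zero, List.getElem?_cons_succ, Option.some.injEq,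
    exists_eq_left']
  refine ⟨_, _, hs, fun t₁ h₁ => ?_⟩
  revert hl hso
  generalize stack a xs = st
  intro hl hso
  cases hso with
  | nil => exact absurd rfl hx
  | @cons _ _ u s st _ _ =>
    rw [List.length_cons] at hl
    simp only [encStack_cons, Expr.wp, Val.onNum, List.getElem?_cons_zero, List.getElem?_cons_succ, Option.some.injEq,
    exists_eq_left']
    exact ⟨_, _, fn_collapse a st u, fun t₂ h₂ => ⟨rfl, by omega⟩⟩

/-- The list itself serves as the unary counter. -/
theorem fn_root (a : ℕ → ℕ) (xs : List Formula) : ∀ r c : ℕ,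
    prefixProgram.Fn 7 (.pair (encList a xs) (.pair (.num r) (.num c)))
      (.num (rootAux xs.length r c)) (30 * xs.length + 10) := by
  induction xs with
  | nil =>
    intro r c
    refine .of_wp rootBody rfl ?_
    simp only [rootBody, rootAux, encList_nil, List.length_nil, Expr.wp, Val.onNum, List.getElem?_cons_zero, List.getElem?_cons_succ, Option.some.injEq,
    exists_eq_left']
    exact ⟨trivial, by omega⟩
  | cons x xs ih =>
    intro r c
    refine .of_wp rootBody rfl ?_
    simp only [rootBody, encList_cons, List.length_cons, Expr.wp, Val.onNum, List.getElem?_cons_zero, List.getElem?_cons_succ, Option.some.injEq,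
    exists_eq_left']
    rcases c with _ | c
    · refine ⟨fun _ => ⟨_, _, ih _ _, fun t₁ h₁ => ⟨rfl, by omega⟩⟩, fun h => by omega⟩
    · refine ⟨fun h => by omega, fun _ => ⟨_, _, ih _ _, fun t₁ h₁ => ⟨rfl, by omega⟩⟩⟩

theorem fn_split (a : ℕ → ℕ) (xs : List Formula) : ∀ k : ℕ,
    prefixProgram.Fn 8 (.pair (.num k) (encList a xs))
      (.pair (encList a (xs.take k)) (encList a (xs.drop k))) (30 * xs.length + 20) := by
  induction xs with
  | nil =>
    intro k
    refine .of_wp splitBody rfl ?_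
    simp only [splitBody, encList_nil, List.take_nil, List.drop_nil, Expr.wp, Val.onNum, List.getElem?_cons_zero, List.getElem?_cons_succ, Option.some.injEq,
    exists_eq_left']
    exact ⟨fun _ => ⟨trivial, by omega⟩, fun _ => ⟨trivial, by omega⟩⟩
  | cons x xs ih =>
    intro k
    refine .of_wp splitBody rfl ?_
    simp only [splitBody, encList_cons, List.length_cons, Expr.wp, Val.onNum, List.getElem?_cons_zero, List.getElem?_cons_succ, Option.some.injEq,
    exists_eq_left']
    rcases k with _ | k
    · exact ⟨fun _ => ⟨rfl, by omega⟩, fun h => by omega⟩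
    · refine ⟨fun h => by omega, fun _ => ⟨_, _, ih k, fun t₁ h₁ => ?_⟩⟩
      exact ⟨rfl, by omega⟩

theorem fn_mapNode (a : ℕ → ℕ) (q : Formula) (tl : List Formula) (ys : List Formula) :
    prefixProgram.Fn 11 (.pair (q.enc a) (.pair (encList a ys) (encList a tl)))
      (encList a (ys.map (node q) ++ tl)) (50 * ys.length + 20) := by
  induction ys with
  | nil =>
    refine .of_wp mapNodeBody rfl ?_
    simp only [mapNodeBody, encList_nil, List.map_nil, List.nil_append, Expr.wp, Val.onNum, List.getElem?_cons_zero, List.getElem?_cons_succ, Option.some.injEq,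
    exists_eq_left']
    exact ⟨trivial, by omega⟩
  | cons y ys ih =>
    refine .of_wp mapNodeBody rfl ?_
    simp only [mapNodeBody, encList_cons, List.map_cons, List.cons_append, List.length_cons, Expr.wp, Val.onNum, List.getElem?_cons_zero, List.getElem?_cons_succ, Option.some.injEq,
    exists_eq_left']
    exact ⟨_, _, fn_node a q y, fun t₁ h₁ => ⟨_, _, ih, fun t₂ h₂ => ⟨rfl, by omega⟩⟩⟩

theorem fn_append (a : ℕ → ℕ) (ys : List Formula) (xs : List Formula) :
    prefixProgram.Fn 12 (.pair (encList a xs) (encList a ys)) (encList a (xs ++ ys))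
      (20 * xs.length + 10) := by
  induction xs with
  | nil =>
    refine .of_wp appendBody rfl ?_
    simp only [appendBody, encList_nil, List.nil_append, Expr.wp, Val.onNum, List.getElem?_cons_zero, List.getElem?_cons_succ, Option.some.injEq,
    exists_eq_left']
    exact ⟨trivial, by omega⟩
  | cons x xs ih =>
    refine .of_wp appendBody rfl ?_
    simp only [appendBody, encList_cons, List.cons_append, List.length_cons, Expr.wp, Val.onNum, List.getElem?_cons_zero, List.getElem?_cons_succ, Option.some.injEq,
    exists_eq_left']
    exact ⟨_, _, ih, fun t₁ h₁ => ⟨rfl, by omega⟩⟩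

theorem fn_inputs (a : ℕ → ℕ) (k : ℕ) : ∀ i : ℕ,
    prefixProgram.Fn 17 (.pair (.num i) (.ofList ((List.range' i k).map fun j => .num (a j))))
      (encList a (inputs i k)) (20 * k + 10) := by
  induction k with
  | zero =>
    intro i
    refine .of_wp inputsBody rfl ?_
    simp only [inputsBody, inputs, encList_nil, List.range'_zero, List.map_nil, Val.ofList, Expr.wp, Val.onNum, List.getElem?_cons_zero, List.getElem?_cons_succ, Option.some.injEq,
    exists_eq_left']
    exact ⟨trivial, by omega⟩
  | succ k ih =>
    intro i
    refine .of_wp inputsBody rfl ?_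
    simp only [inputsBody, inputs, encList_cons, List.range'_succ, List.map_cons, Val.ofList, Expr.wp, Val.onNum, List.getElem?_cons_zero, List.getElem?_cons_succ, Option.some.injEq,
    exists_eq_left']
    exact ⟨_, _, ih (i + 1), fun t₁ h₁ => ⟨rfl, by omega⟩⟩

theorem fn_length (vs : List Val) :
    prefixProgram.Fn 18 (.ofList vs) (.num vs.length) (20 * vs.length + 10) := by
  induction vs with
  | nil =>
    refine .of_wp lengthBody rfl ?_
    simp only [lengthBody, Val.ofList, Expr.wp, Val.onNum, List.getElem?_cons_zero, List.getElem?_cons_succ, Option.some.injEq,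
    exists_eq_left']
    exact ⟨rfl, by omega⟩
  | cons v vs ih =>
    refine .of_wp lengthBody rfl ?_
    simp only [lengthBody, Val.ofList, List.length_cons, Expr.wp, Val.onNum, List.getElem?_cons_zero, List.getElem?_cons_succ, Option.some.injEq,
    exists_eq_left']
    exact ⟨_, _, ih, fun t₁ h₁ => ⟨rfl, by omega⟩⟩

theorem fn_insertGate (u w : ℕ) (G : List (ℕ × ℕ)) : ∀ v : ℕ,
    prefixProgram.Fn 14 (.pair (.pair (.num u) (.num w)) (.pair (.num v) (encGates G)))
      (.pair (encGates (insertGate (u, w) v G).1) (.num (insertGate (u, w) v G).2))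
      (60 * G.length + 20) := by
  induction G with
  | nil =>
    intro v
    refine .of_wp insertBody rfl ?_
    simp only [insertBody, insertGate, encGates_nil, encGates_cons, Expr.wp, Val.onNum, List.getElem?_cons_zero, List.getElem?_cons_succ, Option.some.injEq,
    exists_eq_left']
    exact ⟨trivial, by omega⟩
  | cons e G ih =>
    obtain ⟨u', w'⟩ := e
    intro v
    refine .of_wp insertBody rfl ?_
    simp only [insertBody, insertGate, encGates_cons, List.length_cons, Expr.wp, Val.onNum, List.getElem?_cons_zero, List.getElem?_cons_succ, Option.some.injEq,
    exists_eq_left']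
    constructor <;> intro h
    · have : (u', w') = (u, w) := Prod.ext (show u' = u by omega) (show w' = w by omega)
      rw [if_pos this]
      exact ⟨rfl, by omega⟩
    · have : (u', w') ≠ (u, w) := by
        intro h
        obtain ⟨rfl, rfl⟩ := Prod.mk.inj h
        omega
      rw [if_neg this]
      exact ⟨_, _, ih (v + 1), fun t₁ h₁ => ⟨rfl, by omega⟩⟩

theorem length_insertGate_le (e : ℕ × ℕ) (G : List (ℕ × ℕ)) (v : ℕ) :
    (insertGate e v G).1.length ≤ G.length + 1 := by
  obtain ⟨-, -, -, h | ⟨-, h⟩⟩ := insertGate_spec e G v <;> simp [h]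

theorem length_emit_le (n : ℕ) (t : Formula) : ∀ G : List (ℕ × ℕ),
    (emit n t G).1.length + 1 ≤ G.length + t.leaves.length := by
  induction t with
  | leaf i => intro G; simp [emit]
  | node l r hl hr =>
    intro G
    have h1 := hl G
    have h2 := hr (emit n l G).1
    have h3 := length_insertGate_le ((emit n l G).2, (emit n r (emit n l G).1).2)
      (emit n r (emit n l G).1).1 n
    rw [emit, leaves_node, List.length_append]
    omega

/-- M bounds the length of every intermediate list of gates, and thus the linear search made at each
node; by `length_emit_le`, a formula adds fewer gates than it has leaves. -/
theorem fn_emit (a : ℕ → ℕ) (n M : ℕ) (t : Formula) : ∀ G : List (ℕ × ℕ),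
    G.length + t.leaves.length ≤ M →
    prefixProgram.Fn 15 (.pair (t.enc a) (.pair (.num n) (encGates G)))
      (.pair (encGates (emit n t G).1) (.num (emit n t G).2))
      ((t.inner.length + t.leaves.length) * (60 * M + 100)) := by
  induction t with
  | leaf i =>
    intro G h
    refine .of_wp emitBody rfl ?_
    simp only [emitBody, emit, enc, inner_leaf, List.length_nil, leaves_leaf, List.length_singleton, Expr.wp, Val.onNum, List.getElem?_cons_zero, List.getElem?_cons_succ, Option.some.injEq,
    exists_eq_left']
    exact ⟨trivial, by omega⟩
  | node l r hl hr =>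
    intro G h
    rw [leaves_node, List.length_append] at h ⊢
    rw [inner_node, List.length_cons, List.length_append]
    have h1 := length_emit_le n l G
    have h2 := length_emit_le n r (emit n l G).1
    refine .of_wp emitBody rfl ?_
    simp only [emitBody, emit, enc, Expr.wp, Val.onNum, List.getElem?_cons_zero, List.getElem?_cons_succ, Option.some.injEq,
    exists_eq_left']
    refine ⟨_, _, hl G (by omega), fun t₁ h₃ => ?_⟩
    dsimp only
    refine ⟨_, _, hr (emit n l G).1 (by omega), fun t₂ h₄ => ?_⟩
    dsimp only
    refine ⟨_, _, fn_insertGate _ _ _ n, fun t₃ h₅ => ⟨rfl, ?_⟩⟩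
    have h6 : 60 * (emit n r (emit n l G).1).1.length ≤ 60 * M := by omega
    nlinarith

end Formula

namespace Formula

open PrefixProgram

theorem fn_emitAll (a : ℕ → ℕ) (n M : ℕ) (ts : List Formula) : ∀ G : List (ℕ × ℕ),
    G.length + ts.length * n ≤ M → (∀ t ∈ ts, t.leaves.length ≤ n) →
    prefixProgram.Fn 16 (.pair (encList a ts) (.pair (.num n) (encGates G)))
      (.pair (encGates (emitAll n ts G).1) (.ofList ((emitAll n ts G).2.map .num)))
      (ts.length * (2 * n * (60 * M + 100) + 50) + 20) := by
  induction ts with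
  | nil =>
    intro G _ _
    refine .of_wp emitAllBody rfl ?_
    simp only [emitAllBody, emitAll, encList_nil, List.map_nil, Val.ofList, List.length_nil, Expr.wp, Val.onNum, List.getElem?_cons_zero, List.getElem?_cons_succ, Option.some.injEq,
    exists_eq_left']
    exact ⟨trivial, by omega⟩
  | cons t ts ih =>
    intro G hM hn
    have ht := hn t (by simp)
    rw [List.length_cons, add_mul, one_mul] at hM ⊢
    have h1 := length_emit_le n t G
    refine .of_wp emitAllBody rfl ?_
    simp only [emitAllBody, emitAll, encList_cons, Expr.wp, Val.onNum, List.getElem?_cons_zero, List.getElem?_cons_succ, Option.some.injEq,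
    exists_eq_left']
    refine ⟨_, _, fn_emit a n M t G (by omega), fun t₁ h₃ => ?_⟩
    dsimp only
    refine ⟨_, _, ih (emit n t G).1 (by omega) (fun t h => hn t (by simp [h])),
      fun t₂ h₄ => ?_⟩
    refine ⟨rfl, ?_⟩
    have h5 := length_inner t
    have h6 : (t.inner.length + t.leaves.length) * (60 * M + 100) ≤ 2 * n * (60 * M + 100) :=
      Nat.mul_le_mul_right _ (by omega)
    omega

theorem fn_heads (a : ℕ → ℕ) {r : ℕ} (hr : r ≠ 0) (xs : List Formula) :
    prefixProgram.Fn 9 (.pair (.num r) (encList a xs)) (encList a (heads a r xs))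
      (1000 * xs.length * xs.length + 200) := by
  induction xs using blocks_induction hr with
  | short xs h =>
    refine .of_wp headsBody rfl ?_
    have hs := fn_split a xs r
    rw [List.drop_of_length_le h] at hs
    rw [heads_of_le h]
    simp only [headsBody, Expr.wp, Val.onNum, List.getElem?_cons_zero, List.getElem?_cons_succ, Option.some.injEq,
    exists_eq_left']
    refine ⟨_, _, hs, fun t₁ h₁ => ?_⟩
    simp only [encList_nil, Expr.wp, Val.onNum, List.getElem?_cons_zero, List.getElem?_cons_succ, Option.some.injEq,
    exists_eq_left']
    exact ⟨trivial, by nlinarith [Nat.le_mul_self xs.length]⟩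
  | long xs h ih =>
    have hs := fn_split a xs r
    have hc := fn_combine a (xs := xs.take r) (by
      rw [← List.length_pos_iff, List.length_take]; omega)
    rw [heads_of_lt hr h]
    have hl : (xs.take r).length = r := by rw [List.length_take]; omega
    have hd : (xs.drop r).length + r = xs.length := by rw [List.length_drop]; omega
    rw [hl] at hc
    refine .of_wp headsBody rfl ?_
    simp only [headsBody, Expr.wp, Val.onNum, List.getElem?_cons_zero, List.getElem?_cons_succ, Option.some.injEq,
    exists_eq_left']
    refine ⟨_, _, hs, fun t₁ h₁ => ?_⟩
    revert ih hd
    rcases xs.drop r with _ | ⟨y, ys⟩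
    · intro _ hd
      simp at hd
      omega
    · intro ih hd
      simp only [encList_cons, Expr.wp, Val.onNum, List.getElem?_cons_zero, List.getElem?_cons_succ, Option.some.injEq,
    exists_eq_left'] at ih ⊢
      refine ⟨_, _, hc, fun t₂ h₂ => ⟨_, _, ih, fun t₃ h₃ => ⟨rfl, ?_⟩⟩⟩
      have hr1 : 1 ≤ r := Nat.pos_of_ne_zero hr
      have hy : 1 ≤ (y :: ys).length := by simp
      generalize (y :: ys).length = l at *
      rw [← hd] at h₁ ⊢
      nlinarith

/-- A cost of F that is linear in the block length, with a common factor K, adds up to K times the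
total length. -/
theorem fn_distribute (a : ℕ → ℕ) {F : List Formula → List Formula} {r n K : ℕ}
    (hF : ∀ ys : List Formula, ys.length ≤ r → (F ys).length = ys.length ∧
      prefixProgram.Fn 13 (encList a ys) (encList a (F ys)) (K * ys.length + 20))
    (qs : List Formula) : ∀ xs : List Formula, xs.length ≤ n →
      prefixProgram.Fn 10 (.pair (.num r) (.pair (encList a qs) (encList a xs)))
        (encList a (distribute F r qs xs))
        (K * xs.length + qs.length * (100 * n + 200) + 20) := by
  induction qs with
  | nil =>
    intro xs h
    refine .of_wp distributeBody rfl ?_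
    simp only [distributeBody, distribute, encList_nil, Expr.wp, Val.onNum, List.getElem?_cons_zero, List.getElem?_cons_succ, Option.some.injEq,
    exists_eq_left']
    exact ⟨trivial, by omega⟩
  | cons q qs ih =>
    intro xs h
    have hs := fn_split a xs r
    have hl : (xs.take r).length + (xs.drop r).length = xs.length := by
      rw [← List.length_append, List.take_append_drop]
    obtain ⟨h1, h2⟩ := hF (xs.take r) (by simp)
    have h3 := ih (xs.drop r) (by omega)
    have h4 := fn_mapNode a q (distribute F r qs (xs.drop r)) (F (xs.take r))
    rw [h1] at h4
    refine .of_wp distributeBody rfl ?_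
    simp only [distributeBody, distribute, encList_cons, Expr.wp, Val.onNum, List.getElem?_cons_zero, List.getElem?_cons_succ, Option.some.injEq,
    exists_eq_left']
    refine ⟨_, _, hs, fun t₁ h₅ => ?_⟩
    dsimp only
    refine ⟨_, _, h2, fun t₂ h₆ => ⟨_, _, h3, fun t₃ h₇ => ⟨_, _, h4, fun t₄ h₈ => ⟨rfl, ?_⟩⟩⟩⟩
    rw [← hl, List.length_cons, mul_add, add_mul, one_mul]
    omega

/-- With N = r + d, the bounds r ≤ 2N/3 and m ≤ N/2 show that the recursive calls use at most the
share 4/9 + 1/8 of 5000 N³. The rest absorbs the quadratic work of splitting and combining. -/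
theorem prefixes_cost {r d m : ℕ} (hr0 : r ≠ 0) (hn : 2 ≤ r + d) (hr : r * r < r + d + r) (hr1 : r + d ≤ r * (r + 1))
    (hm : m * r < r + d) :
    5000 * r ^ 3 + 5000 * m ^ 3 + 5000 * r ^ 2 * d + m * (100 * (r + d) + 200)
      + 1000 * (r + d) * (r + d) + 100 * (r + d) + 1000 ≤ 5000 * (r + d) ^ 3 := by
  have h3r : 3 * r ≤ 2 * (r + d) := by nlinarith
  have h2m : 2 * m ≤ r + d := by
    rcases Nat.lt_or_ge r 2 with h | h
    · obtain rfl : r = 1 := by omega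
      have : m ≤ 1 := by nlinarith
      omega
    · nlinarith
  have e4 : 5000 * r ^ 3 + 5000 * r ^ 2 * d = 5000 * (r ^ 2 * (r + d)) := by ring
  generalize r + d = N at *
  have e1 := Nat.pow_le_pow_left h3r 2
  have e2 := Nat.pow_le_pow_left h2m 3
  have e3 := Nat.mul_le_mul_right N e1
  have e5 : m * (100 * N + 200) ≤ N * (100 * N + 200) := Nat.mul_le_mul_right _ (by omega)
  have e6 : 2 * N ^ 2 ≤ N ^ 3 := by
    rw [pow_succ N 2, mul_comm]; exact Nat.mul_le_mul_left _ hn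
  have e7 : 2 * N ≤ N ^ 2 := by
    rw [pow_two]; exact Nat.mul_le_mul_right _ hn
  have e8 : (3 * r) ^ 2 * N = 9 * (r ^ 2 * N) := by ring
  have e9 : (2 * N) ^ 2 * N = 4 * N ^ 3 := by ring
  have e10 : (2 * m) ^ 3 = 8 * m ^ 3 := by ring
  have e11 : N * (100 * N + 200) = 100 * N ^ 2 + 200 * N := by ring
  have e12 : 1000 * N * N = 1000 * N ^ 2 := by ring
  omega

/-- The program carries no recursion bound k: any k that is at least the length describes the same
run. -/
theorem fn_prefixes (a : ℕ → ℕ) (k : ℕ) : ∀ xs : List Formula, xs.length ≤ k →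
    prefixProgram.Fn 13 (encList a xs) (encList a (prefixes a k xs))
      (5000 * xs.length ^ 3 + 20) := by
  induction k with
  | zero =>
    intro xs h
    obtain rfl := List.length_eq_zero_iff.1 (Nat.le_zero.1 h)
    refine .of_wp prefixesBody rfl ?_
    simp only [prefixesBody, prefixes, encList_nil, Expr.wp, Val.onNum, List.getElem?_cons_zero, List.getElem?_cons_succ, Option.some.injEq,
    exists_eq_left']
    exact ⟨trivial, by omega⟩
  | succ k ih =>
    intro xs h
    rcases xs with _ | ⟨x, _ | ⟨y, ys⟩⟩
    · refine .of_wp prefixesBody rfl ?_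
      simp only [prefixes, List.length_nil, zero_le, if_true]
      simp only [prefixesBody, encList_nil, Expr.wp, Val.onNum, List.getElem?_cons_zero, List.getElem?_cons_succ, Option.some.injEq,
    exists_eq_left']
      exact ⟨trivial, by omega⟩
    · refine .of_wp prefixesBody rfl ?_
      simp only [prefixes, List.length_singleton, le_refl, if_true]
      simp only [prefixesBody, encList_nil, encList_cons, Expr.wp, Val.onNum, List.getElem?_cons_zero, List.getElem?_cons_succ, Option.some.injEq,
    exists_eq_left']
      exact ⟨trivial, by omega⟩
    · rw [prefixes, if_neg (by simp)]
      obtain ⟨xs, hxs⟩ : ∃ xs, xs = x :: y :: ys := ⟨_, rfl⟩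
      have hn : 2 ≤ xs.length := by simp [hxs]
      have henc : encList a xs = .pair (x.enc a) (.pair (y.enc a) (encList a ys)) := by
        rw [hxs, encList_cons, encList_cons]
      rw [← hxs] at h ⊢
      have hx : xs ≠ [] := by simp [hxs]
      clear hxs
      have hroot := fn_root a xs 0 0
      rw [show rootAux xs.length 0 0 = root xs.length from rfl] at hroot
      have hr : root xs.length ≠ 0 := root_ne_zero (by omega)
      have hrx : root xs.length < xs.length := root_lt hn
      obtain ⟨hr1, hr2⟩ := root_spec (show 1 ≤ xs.length by omega)
      generalize root xs.length = r at *
      have hm := length_heads_mul_lt (a := a) hr hx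
      have hm' := length_heads_lt (a := a) hr hx
      have hsplit := fn_split a xs r
      have hheads := fn_heads a hr xs
      have hl : (xs.take r).length = r := by rw [List.length_take]; omega
      have hd : (xs.drop r).length ≤ xs.length := by simp
      have hfirst := ih (xs.take r) (by omega)
      have hq := ih (heads a r xs) (by omega)
      have hrest := fn_distribute a (F := prefixes a k) (r := r) (n := xs.length)
        -- For l ≤ r the cubic cost 5000 l³ is at most (5000 r²) l, hence linear in l.
        (K := 5000 * r ^ 2) (fun ys hy => ⟨length_prefixes (by omega),
          (ih ys (by omega)).mono (by
            have := Nat.mul_le_mul_right ys.length (Nat.pow_le_pow_left hy 2)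
            nlinarith)⟩)
        (prefixes a k (heads a r xs)) (xs.drop r) hd
      have happ := fn_append a (distribute (prefixes a k) r (prefixes a k (heads a r xs))
        (xs.drop r)) (prefixes a k (xs.take r))
      rw [length_prefixes (by omega), hl] at happ
      rw [length_prefixes (by omega)] at hrest
      rw [hl] at hfirst
      rw [henc] at hroot hsplit hheads ⊢
      refine .of_wp prefixesBody rfl ?_
      simp only [prefixesBody, Expr.wp, Val.onNum, List.getElem?_cons_zero, List.getElem?_cons_succ, Option.some.injEq,
    exists_eq_left']
      refine ⟨_, _, hroot, fun t₁ h₁ => ⟨_, _, hsplit, fun t₂ h₂ => ?_⟩⟩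
      dsimp only
      refine ⟨_, _, hfirst, fun t₃ h₃ => ⟨_, _, hheads, fun t₄ h₄ => ⟨_, _, hq, fun t₅ h₅ =>
        ⟨_, _, hrest, fun t₆ h₆ => ⟨_, _, happ, fun t₇ h₇ => ⟨rfl, ?_⟩⟩⟩⟩⟩⟩
      rw [List.length_drop] at h₆
      generalize (heads a r xs).length = m at *
      generalize xs.length = n at *
      obtain ⟨d, rfl⟩ := Nat.exists_eq_add_of_le hrx.le
      rw [Nat.add_sub_cancel_left] at h₆
      have := prefixes_cost hr hn hr2 hr1 hm
      omega

theorem fn_main (a : ℕ → ℕ) {n : ℕ} (hn : 3 ≤ n) :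
    prefixProgram.Fn 0 (.ofList ((List.range' 0 n).map fun j => .num (a j)))
      (.pair (encGates (emitAll n (prefixes a n (inputs 0 n)) []).1)
        (.ofList ((emitAll n (prefixes a n (inputs 0 n)) []).2.map .num)))
      (10000 * n ^ 4) := by
  have hl : (inputs 0 n).length = n := by rw [inputs_eq_map]; simp
  have hin := fn_inputs a n 0
  have hpre := fn_prefixes a n (inputs 0 n) (by omega)
  have hlen := fn_length ((List.range' 0 n).map fun j => .num (a j))
  have hlp := length_prefixes (a := a) (k := n) (xs := inputs 0 n) (by omega)
  have hleaves : ∀ t ∈ prefixes a n (inputs 0 n), t.leaves.length ≤ n := by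
    intro t ht
    have h1 := List.mem_map_of_mem (f := leaves) ht
    rw [map_leaves_prefixes a n _ (by omega)] at h1
    obtain ⟨i, hi, h2⟩ := List.getElem_of_mem h1
    rw [← h2, getElem_scanWords, inputs_eq_map, List.map_map, ← List.map_take]
    have : (leaves ∘ leaf) = fun i => [i] := rfl
    rw [List.nil_append, this, ← List.flatMap_def]
    simp
  -- There are n formulas with at most n leaves each, so at most n² gates ever occur; O(n²) searches
  -- in such a list make the total quartic.
  have hemit := fn_emitAll a n (n * n) (prefixes a n (inputs 0 n)) [] (by simp [hlp, hl]) hleaves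
  rw [hlp] at hemit
  rw [hl] at hpre hemit
  rw [List.length_map, List.length_range'] at hlen
  refine .of_wp mainBody rfl ?_
  simp only [mainBody, Expr.wp, Val.onNum, List.getElem?_cons_zero, List.getElem?_cons_succ, Option.some.injEq,
    exists_eq_left']
  refine ⟨_, _, hin, fun t₁ h₁ => ⟨_, _, hpre, fun t₂ h₂ => ⟨_, _, hlen, fun t₃ h₃ =>
    ⟨_, _, hemit, fun t₄ h₄ => ⟨rfl, ?_⟩⟩⟩⟩⟩
  have e1 : n * (2 * n * (60 * (n * n) + 100) + 50) + 20 = 120 * n ^ 4 + 200 * n ^ 2 + 50 * n + 20 := by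
    ring
  have e2 : 3 * n ^ 3 ≤ n ^ 4 := by
    rw [pow_succ n 3, mul_comm]; exact Nat.mul_le_mul_left _ hn
  have e3 : 3 * n ^ 2 ≤ n ^ 3 := by
    rw [pow_succ n 2, mul_comm]; exact Nat.mul_le_mul_left _ hn
  have e4 : 3 * n ≤ n ^ 2 := by
    rw [pow_two]; exact Nat.mul_le_mul_right _ hn
  omega

end Formula

theorem mainTheorem10 :
    ∃ (P : Program) (p : Polynomial ℕ),
      ∀ (n : ℕ), 3 ≤ n → ∀ a : Fin n → ℕ,
        ∃ C : Circuit n n,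
          (∃ t : ℕ, t ≤ p.eval n ∧ P.HaltsWith (encodeTimes a) C.encode t) ∧
          (∀ op : Bool → Bool → Bool,
            (∀ u v w : Bool, op (op u v) w = op u (op v w)) → C.SolvesPrefix op) ∧
          (C.delay a : ℝ) ≤
            Real.logb 2 (weight a) + 3 * Real.logb 2 (Real.logb 2 n) + 0.007 ∧
          (C.size : ℝ) ≤ 3.114 * n * Real.logb 2 (Real.logb 2 n) := by
  refine ⟨prefixProgram, .C 10000 * .X ^ 4 + .C 2, fun n hn a => ?_⟩
  obtain ⟨a', ha⟩ : ∃ a' : ℕ → ℕ, ∀ i : Fin n, a' i = a i :=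
    ⟨fun j => if h : j < n then a ⟨j, h⟩ else 0, by simp⟩
  obtain ⟨C, h1, h2, h3⟩ := Formula.exists_prefix_circuit hn a a' ha
  refine ⟨C, ?_, h3⟩
  have hin : encodeTimes a = .ofList ((List.range' 0 n).map fun j => .num (a' j)) := by
    rw [encodeTimes, ← List.range_eq_range', ← List.map_coe_finRange_eq_range, List.map_map,
      List.ofFn_eq_map]
    congr 2
    funext i
    simp [ha]
  have hout : C.encode = .pair (Formula.encGates (Formula.emitAll n
        (Formula.prefixes a' n (Formula.inputs 0 n)) []).1)
      (.ofList ((Formula.emitAll n (Formula.prefixes a' n (Formula.inputs 0 n)) []).2.map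
        .num)) := by
    rw [Circuit.encode, ← h1, ← h2, List.map_ofFn]
    rfl
  obtain ⟨body, hb, t, ht, hs⟩ := Formula.fn_main a' hn
  rw [← hin, ← hout] at hs
  -- One step reads the argument and one is the call; these are the summand 2 of the polynomial.
  exact ⟨1 + t + 1, by simp; omega, .call hb (.var rfl) hs⟩
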